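/- Let $(a,b,c)$ be positive real numbers with $a<b<c$, put $c_0:=c-\lfloor c/b\rfloor b$, and assume $b-a<c_0<a$, $\lfloor c/b\rfloor\ge 2$, $a/b=p/q$ for coprime positive integers $p,q$, and $c/b\in\mathbb Z/q$. Let $\mathcal S=\mathcal S_{a,b,c}$ be the set of all $t\in\mathbb R$ for which there is a binary vector $\mathbf x=(\mathbf x(\lambda))_{\lambda\in b\mathbb Z}\in\{0,1\}^{b\mathbb Z}$ with $\mathbf x(0)=1$ and $\sum_{\lambda\in b\mathbb Z}\chi_{[0,c)}(t-\mu+\lambda)\,\mathbf x(\lambda)=1$ for all $\mu\in a\mathbb Z$. Let $R=R_{a,b,c}:\mathbb R\to\mathbb R$ be the piecewise linear transformation $$R(t)=\begin{cases} t+\lfloor c/b\rfloor b+b & \text{if } t\in[0,c_0+a-b)+a\mathbb Z,\\ t & \text{if } t\in[c_0+a-b,c_0)+a\mathbb Z,\\ t+\lfloor c/b\rfloor b & \text{if } t\in[c_0,a)+a\mathbb Z,\end{cases}$$ and let $R^n$ be its $n$-th iterate. Assume $\mathcal S\neq\emptyset$. Then there are $\delta\in[0,c_0+a-b]\cap b\mathbb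 Z/q$, $\delta'\in[c_0-a,0]\cap b\mathbb Z/q$ and nonnegative integers $N_1,N_2$ such that, writing $$G_n:=R^n\big(c-c_0+[\delta',b-a+\delta)\big)+a\mathbb Z,\qquad H_m:=R^m\big([c_0+a-b-\delta,c_0-\delta')\setminus[c_0+a-b,c_0)\big)+a\mathbb Z,$$ the following hold. (i) $\delta\delta'=0$. (ii) $G_n=R^n(c-c_0+b-a+\delta)+[a-b+\delta'-\delta,0)+a\mathbb Z$ for all $0\le n\le N_1$; moreover $G_{N_1}=[c_0+a-b-\delta,c_0-\delta')+a\mathbb Z$ and $R^{N_1}(c-c_0+b-a+\delta)+a\mathbb Z=c_0-\delta'+a\mathbb Z$. (iii) $H_m=R^m(c_0-\delta')+[\delta'-\delta,0)+a\mathbb Z$ for all $1\le m\le N_2$, and $H_{N_2}=[\delta',\delta)+a\mathbb Z$. (iii)$'$ If $\delta=\delta'=0$, then $R^{N_2}(c_0)\in a\mathbb Z$. (iv) If $\delta-\delta'\ne0$, then the sets $G_n$ $(0\le n\le N_1)$ and $H_m$ $(1\le m\le N_2)$, each enlarged by neighboring intervals of length $b/(2q)$ at each side (that is, each replaced by its Minkowski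 sum with $[-b/(2q),b/(2q))$), are mutually disjoint. (iv)$'$ If $\delta=\delta'=0$, then the sets $G_n=R^n([c-c_0,c-c_0+b-a))+a\mathbb Z$ $(0\le n\le N_1)$, enlarged by neighboring intervals of length $b/(2q)$ at each side, and the sets $R^m(c_0)+[-b/(2q),b/(2q))+a\mathbb Z$ $(1\le m\le N_2)$ are mutually disjoint. (v) $$\mathbb R\setminus\mathcal S=\Big(\bigcup_{n=0}^{N_1}G_n\Big)\cup\Big(\bigcup_{m=1}^{N_2}\big(R^m[c_0+a-b-\delta,c_0-\delta')+a\mathbb Z\big)\Big)=\bigcup_{n=0}^{N_1+N_2}R^n\big(c-c_0+[\delta',b-a+\delta)+a\mathbb Z\big).$$ (vi) There is $h>0$ such that $$\mathcal S=\bigcup_{n=0}^{N_1+N_2}\Big(R^n(c-c_0+b-a+\delta)+[0,h)+a\mathbb Z\Big),$$ this union is disjoint, and $(N_1+N_2+1)(h+\delta-\delta')+(N_1+1)(b-a)=a$. -/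

import Mathlib

open scoped Pointwise

noncomputable section

namespace GaborABC

/-- The lattice `r ℤ` in the real line. -/
def lattice (r : ℝ) : Set ℝ := Set.range fun k : ℤ => (k : ℝ) * r

/-- `c₀ = c - ⌊c / b⌋ b`. -/
def c₀ (b c : ℝ) : ℝ := c - (⌊c / b⌋ : ℝ) * b

/-- The infinite matrix `M_{a,b,c}(t) = (χ_{[0,c)}(t - μ + ν))` with rows `μ ∈ aℤ` and columns
`ν ∈ bℤ`; the row `μ = m a` and the column `ν = l b` are addressed by the integers `m` and `l`. -/
def infMatrix (a b c t : ℝ) : Matrix ℤ ℤ ℝ := fun m l =>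
  Set.indicator (Set.Ico 0 c) (fun _ => (1 : ℝ)) (t - (m : ℝ) * a + (l : ℝ) * b)

/-- Binary vectors on `bℤ` (addressed by `ℤ`) that take the value one at the origin. -/
def binaryVectors : Set (ℤ → ℝ) := {x | (∀ l, x l = 0 ∨ x l = 1) ∧ x 0 = 1}

/-- The set `S_{a,b,c}` of all real `t` such that `M_{a,b,c}(t) x = 1` (all entries one) for some
binary vector `x` with value one at the origin. -/
def invSet (a b c : ℝ) : Set ℝ :=
  {t | ∃ x ∈ binaryVectors, ∀ m : ℤ, HasSum (fun l : ℤ => infMatrix a b c t m l * x l) 1}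

open Classical in
/-- The piecewise linear transformation `R_{a,b,c}`. When `0 < a < b` and `b - a < c₀ < a`, the
remaining case is `t ∈ [c₀, a) + aℤ`. -/
def R (a b c t : ℝ) : ℝ :=
  if t ∈ Set.Ico 0 (c₀ b c + a - b) + lattice a then t + (⌊c / b⌋ : ℝ) * b + b
  else if t ∈ Set.Ico (c₀ b c + a - b) (c₀ b c) + lattice a then t
  else t + (⌊c / b⌋ : ℝ) * b

/-- The periodic gap `R^n (c - c₀ + [δ', b - a + δ)) + aℤ`. -/
def bigGap (a b c δ δ' : ℝ) (n : ℕ) : Set ℝ :=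
  (R a b c)^[n] '' Set.Ico (c - c₀ b c + δ') (c - c₀ b c + (b - a + δ)) + lattice a

/-- The periodic gap `R^m ([c₀ + a - b - δ, c₀ - δ') \ [c₀ + a - b, c₀)) + aℤ`. -/
def smallGap (a b c δ δ' : ℝ) (m : ℕ) : Set ℝ :=
  (R a b c)^[m] '' (Set.Ico (c₀ b c + a - b - δ) (c₀ b c - δ') \
    Set.Ico (c₀ b c + a - b) (c₀ b c)) + lattice a

/-- `E` together with neighboring intervals of length `r` at each side: as
`[x, y) + [-r, r) = [x - r, y + r)` for `x < y`, this is the Minkowski sum `E + [-r, r)`. -/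
def fatten (r : ℝ) (E : Set ℝ) : Set ℝ := E + Set.Ico (-r) r

end GaborABC

end

/-! ### The integer model of the dynamics -/

namespace GaborABC

/-! All breakpoints are multiples of u = b/q, so t matters only through ⌊t/u⌋, and the problem lives
on ℤ with a = p, b = q, c = Mq + r, c₀ = r. A binary solution is a set of points t + λ with exactly
one point in each window [μ, μ + c). The successor of a point is then forced to be its image under
R, and a point of the black hole [c₀ + a - b, c₀) + aℤ has no admissible successor. Hence S
corresponds to the integers whose orbit avoids the hole (`mem_core_iff_exists_tiling`,
`Scaled.invSet_eq`).

Modulo p, R agrees with `liftZ`, which is strictly increasing off the hole: it closes up the hole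
and opens a slit of length q - p at the image of the origin. On the core it is an increasing
bijection commuting with x ↦ x + p. An increasing enumeration σ of the core turns these two maps
into i ↦ i + k and i ↦ i + s (`exists_coding`), that is, into a rotation of ℤ/s.

The rotation carries gaps between consecutive core points to gaps. Lengths are kept, except that the
gap at the origin (index -1) gains q - p and the gap around the hole (index i₁) loses q - p. Lengths
must return after s steps, so the orbit of -1 meets i₁ (`IsSplit.exists_hit`): the gaps up to that
time are the G_n, those afterwards the H_m. A gap on any other orbit would never reach the hole, so
it is empty (`Orbit.succ_eq`). With d = gcd(s, k), the core therefore consists of L = s/d runs of d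
consecutive integers per period, and adding up lengths over a period gives the last identity.
Finally δδ' = 0 because the core is maximal: if there were room on the same side of both the origin
and the hole, core points shifted by one unit would still avoid the hole (`IsSplit.left_end`,
`IsSplit.right_end`). -/

/-- The parameters `a = p`, `b = q`, `c₀ = r` in units of `b / q`. -/
structure Admissible (p q r : ℤ) : Prop where
  lt : p < q
  sub_lt : q - p < r
  lt' : r < p

/-- `x` lies in the integer black hole `[r + p - q, r) + pℤ`. -/
def InHole (p q r x : ℤ) : Prop := r + p - q ≤ x % p ∧ x % p < r

/-- The transformation `R` on the integers, in units of `b / q`. -/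
def stepZ (p q r M x : ℤ) : ℤ :=
  if x % p < r + p - q then x + M * q + q else if x % p < r then x else x + M * q

/-- A version of `stepZ`, congruent to it modulo `p`, which is monotone off the black hole. -/
def liftZ (p q r M x : ℤ) : ℤ :=
  if x % p < r + p - q then x + M * q + q else if x % p < r then x else x + M * q + p

/-- The integers whose orbit avoids the black hole. -/
def core (p q r M : ℤ) : Set ℤ := {x | ∀ n : ℕ, ¬ InHole p q r ((liftZ p q r M)^[n] x)}

section Basic

variable {p q r M x y j : ℤ}

theorem Admissible.pos (h : Admissible p q r) : 0 < p := by
  have := h.lt; have := h.sub_lt; have := h.lt'; omega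

theorem emod_eq_of_mem (h₁ : p * j ≤ x) (h₂ : x < p * j + p) : x % p = x - p * j := by
  have : x = (x - p * j) + p * j := by ring
  rw [this, Int.add_mul_emod_self_left, Int.emod_eq_of_lt] <;> omega

theorem exists_mul_le (hp : 0 < p) (x : ℤ) : ∃ j, p * j ≤ x ∧ x < p * j + p := by
  refine ⟨x / p, ?_, ?_⟩ <;>
  · have := Int.emod_add_mul_ediv x p
    have := Int.emod_nonneg x hp.ne'
    have := Int.emod_lt_of_pos x hp
    omega

theorem liftZ_left (h : Admissible p q r) (h₁ : p * j ≤ x) (h₂ : x < p * j + (r + p - q)) :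
    liftZ p q r M x = x + M * q + q := by
  have := h.lt; have := h.lt'
  rw [liftZ, emod_eq_of_mem h₁ (by omega), if_pos (by omega)]

theorem liftZ_right (h : Admissible p q r) (h₁ : p * j + r ≤ x) (h₂ : x < p * j + p) :
    liftZ p q r M x = x + M * q + p := by
  have := h.lt; have := h.sub_lt
  rw [liftZ, emod_eq_of_mem (by omega) h₂, if_neg (by omega), if_neg (by omega)]

theorem not_inHole_left (h : Admissible p q r) (h₁ : p * j ≤ x) (h₂ : x < p * j + (r + p - q)) :
    ¬ InHole p q r x := by
  have := h.lt; have := h.lt'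
  rw [InHole, emod_eq_of_mem h₁ (by omega)]
  omega

theorem not_inHole_right (h : Admissible p q r) (h₁ : p * j + r ≤ x) (h₂ : x < p * j + p) :
    ¬ InHole p q r x := by
  have := h.lt; have := h.sub_lt
  rw [InHole, emod_eq_of_mem (by omega) h₂]
  omega

theorem inHole_of_mem (h : Admissible p q r) (h₁ : p * j + (r + p - q) ≤ x)
    (h₂ : x < p * j + r) : InHole p q r x := by
  have := h.sub_lt; have := h.lt'
  rw [InHole, emod_eq_of_mem (j := j) (by omega) (by omega)]
  omega

theorem cases_of_not_inHole (h : Admissible p q r) (hx : ¬ InHole p q r x) :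
    ∃ j, (p * j ≤ x ∧ x < p * j + (r + p - q)) ∨ (p * j + r ≤ x ∧ x < p * j + p) := by
  obtain ⟨j, h₁, h₂⟩ := exists_mul_le h.pos x
  refine ⟨j, ?_⟩
  by_contra hc
  exact hx (inHole_of_mem h (j := j) (by omega) (by omega))

theorem inHole_add_mul : InHole p q r (x + p * j) ↔ InHole p q r x := by
  simp [InHole]

theorem stepZ_add_mul : stepZ p q r M (x + p * j) = stepZ p q r M x + p * j := by
  simp only [stepZ, Int.add_mul_emod_self_left]
  split_ifs <;> ring

theorem liftZ_add_mul : liftZ p q r M (x + p * j) = liftZ p q r M x + p * j := by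
  simp only [liftZ, Int.add_mul_emod_self_left]
  split_ifs <;> ring

theorem stepZ_iterate_add_mul (n : ℕ) :
    (stepZ p q r M)^[n] (x + p * j) = (stepZ p q r M)^[n] x + p * j := by
  induction n generalizing x with
  | zero => rfl
  | succ n ih => rw [Function.iterate_succ_apply, stepZ_add_mul, ih, Function.iterate_succ_apply]

theorem liftZ_iterate_add_mul (n : ℕ) :
    (liftZ p q r M)^[n] (x + p * j) = (liftZ p q r M)^[n] x + p * j := by
  induction n generalizing x with
  | zero => rfl
  | succ n ih => rw [Function.iterate_succ_apply, liftZ_add_mul, ih, Function.iterate_succ_apply]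

theorem exists_liftZ_eq (p q r M x : ℤ) : ∃ j, liftZ p q r M x = stepZ p q r M x + p * j := by
  simp only [liftZ, stepZ]
  split_ifs
  · exact ⟨0, by ring⟩
  · exact ⟨0, by ring⟩
  · exact ⟨1, by ring⟩

theorem exists_liftZ_iterate_eq (p q r M x : ℤ) (n : ℕ) :
    ∃ j, (liftZ p q r M)^[n] x = (stepZ p q r M)^[n] x + p * j := by
  induction n generalizing x with
  | zero => exact ⟨0, by simp⟩
  | succ n ih =>
    obtain ⟨i, hi⟩ := exists_liftZ_eq p q r M x
    obtain ⟨j, hj⟩ := ih (liftZ p q r M x)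
    refine ⟨i + j, ?_⟩
    rw [Function.iterate_succ_apply, hj, hi, stepZ_iterate_add_mul, Function.iterate_succ_apply]
    ring

theorem mem_core_iff_stepZ :
    x ∈ core p q r M ↔ ∀ n : ℕ, ¬ InHole p q r ((stepZ p q r M)^[n] x) := by
  refine forall_congr' fun n => ?_
  obtain ⟨j, hj⟩ := exists_liftZ_iterate_eq p q r M x n
  rw [hj, inHole_add_mul]

theorem not_inHole_of_mem_core (hx : x ∈ core p q r M) : ¬ InHole p q r x := hx 0

theorem liftZ_mem_core (hx : x ∈ core p q r M) : liftZ p q r M x ∈ core p q r M :=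
  fun n => hx (n + 1)

theorem add_mul_mem_core : x + p * j ∈ core p q r M ↔ x ∈ core p q r M := by
  refine forall_congr' fun n => ?_
  rw [liftZ_iterate_add_mul, inHole_add_mul]

theorem stepZ_mem_core (hx : x ∈ core p q r M) : stepZ p q r M x ∈ core p q r M := by
  obtain ⟨j, hj⟩ := exists_liftZ_eq p q r M x
  have := liftZ_mem_core hx
  rwa [hj, add_mul_mem_core] at this

/-- The extra p in the third branch of `liftZ` makes the images of the two sides of the hole abut,
while the image of the next period starts q - p beyond the end of the present one. -/
theorem liftZ_lt_liftZ (h : Admissible p q r) (hx : ¬ InHole p q r x) (hy : ¬ InHole p q r y)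
    (hxy : x < y) : liftZ p q r M x < liftZ p q r M y := by
  obtain ⟨i, hi⟩ := cases_of_not_inHole h hx
  obtain ⟨j, hj⟩ := cases_of_not_inHole h hy
  have h0 := h.pos; have h1 := h.lt; have h2 := h.sub_lt; have h3 := h.lt'
  have hij : p * i ≤ p * j := by
    have : p * i < p * (j + 1) := by rw [mul_add]; omega
    have := lt_of_mul_lt_mul_left this h0.le
    exact mul_le_mul_of_nonneg_left (by omega) h0.le
  rcases hi with hi | hi <;> rcases hj with hj | hj
  · rw [liftZ_left h hi.1 hi.2, liftZ_left h hj.1 hj.2]; omega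
  · rw [liftZ_left h hi.1 hi.2, liftZ_right h hj.1 hj.2]; omega
  · rw [liftZ_right h hi.1 hi.2, liftZ_left h hj.1 hj.2]; omega
  · rw [liftZ_right h hi.1 hi.2, liftZ_right h hj.1 hj.2]; omega

theorem liftZ_injOn (h : Admissible p q r) (hx : ¬ InHole p q r x) (hy : ¬ InHole p q r y)
    (hxy : liftZ p q r M x = liftZ p q r M y) : x = y := by
  rcases lt_trichotomy x y with hlt | rfl | hlt
  · exact absurd hxy (liftZ_lt_liftZ h hx hy hlt).ne
  · rfl
  · exact absurd hxy (liftZ_lt_liftZ h hy hx hlt).ne'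

/-- Pigeonhole: `liftZ` induces an injection on the finite set of residues of the core modulo p,
hence a surjection. -/
theorem exists_liftZ_eq_of_mem_core (h : Admissible p q r) (hy : y ∈ core p q r M) :
    ∃ x ∈ core p q r M, liftZ p q r M x = y := by
  have hp := h.pos
  have key : ∀ z : ℤ, z % p = z + p * (-(z / p)) := fun z => by
    rw [Int.emod_def]; ring
  let A := {z : ℤ // (0 ≤ z ∧ z < p) ∧ z ∈ core p q r M}
  have : Finite A := Set.Finite.subset (Set.finite_Ico 0 p) (fun z hz => hz.1)
  let f : A → A := fun z => ⟨liftZ p q r M z % p,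
    ⟨Int.emod_nonneg _ hp.ne', Int.emod_lt_of_pos _ hp⟩, by rw [key, add_mul_mem_core]; exact liftZ_mem_core z.2.2⟩
  have hf : Function.Injective f := by
    rintro ⟨z, hz, hzc⟩ ⟨w, hw, hwc⟩ hzw
    have hzw : liftZ p q r M z % p = liftZ p q r M w % p := congrArg Subtype.val hzw
    obtain ⟨j, hj⟩ : ∃ j, liftZ p q r M z = liftZ p q r M w + p * j :=
      ⟨liftZ p q r M z / p - liftZ p q r M w / p, by
        rw [key, key (liftZ p q r M w)] at hzw; linear_combination hzw⟩
    rw [← liftZ_add_mul] at hj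
    have : z = w + p * j := liftZ_injOn h (hzc 0) (by simpa [inHole_add_mul] using hwc 0) hj
    have hj0 : z % p = w % p := by rw [this]; simp
    rw [Int.emod_eq_of_lt hz.1 hz.2, Int.emod_eq_of_lt hw.1 hw.2] at hj0
    exact Subtype.ext hj0
  obtain ⟨⟨x, hx, hxc⟩, hxy⟩ := (Finite.injective_iff_surjective.mp hf)
    ⟨y % p, ⟨Int.emod_nonneg _ hp.ne', Int.emod_lt_of_pos _ hp⟩, by rwa [key, add_mul_mem_core]⟩
  have hxy : liftZ p q r M x % p = y % p := congrArg Subtype.val hxy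
  rw [key, key y] at hxy
  refine ⟨x + p * (y / p - liftZ p q r M x / p), by rwa [add_mul_mem_core], ?_⟩
  rw [liftZ_add_mul]
  linear_combination hxy

end Basic


/-! ### Enumerating the core: the dynamics as a rotation -/

theorem add_le_of_strictMono {σ : ℤ → ℤ} (hσ : StrictMono σ) (i : ℤ) (n : ℕ) :
    σ i + n ≤ σ (i + n) := by
  induction n with
  | zero => simp
  | succ n ih =>
    have : σ (i + n) < σ (i + (n + 1 : ℕ)) := hσ (by push_cast; omega)
    push_cast at this ⊢
    omega

theorem exists_index_of_strictMono {σ : ℤ → ℤ} (hσ : StrictMono σ) (y : ℤ) :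
    ∃ i, σ i < y ∧ y ≤ σ (i + 1) := by
  have hex : ∃ i, σ i < y := by
    refine ⟨-(σ 0 - y).toNat - 1, ?_⟩
    have := add_le_of_strictMono hσ (-(σ 0 - y).toNat - 1) ((σ 0 - y).toNat + 1)
    have h0 : (-((σ 0 - y).toNat : ℤ) - 1 + (((σ 0 - y).toNat + 1 : ℕ) : ℤ)) = 0 := by
      push_cast; ring
    rw [h0] at this
    push_cast at this
    omega
  have hbd : ∀ i, σ i < y → i ≤ (y - σ 0).toNat := by
    intro i hi
    by_contra hc
    have h1 := add_le_of_strictMono hσ 0 (y - σ 0).toNat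
    have h2 : σ (0 + ((y - σ 0).toNat : ℤ)) < σ i := hσ (by omega)
    omega
  obtain ⟨i, hi, hmax⟩ := Int.exists_greatest_of_bdd ⟨_, hbd⟩ hex
  refine ⟨i, hi, ?_⟩
  by_contra hc
  have := hmax (i + 1) (by omega)
  omega

theorem orderIso_int_apply (e : ℤ ≃o ℤ) (i : ℤ) : e i = i + e 0 := by
  have hs : ∀ i, e (i + 1) = e i + 1 := fun i => by
    simpa [Order.succ_eq_add_one] using e.map_succ i
  induction i using Int.induction_on with
  | zero => simp
  | succ i ih => rw [hs, ih]; ring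
  | pred i ih =>
    have := hs (-i - 1)
    rw [sub_add_cancel, ih] at this
    linarith

/-- A nonempty locally finite linear order without extreme elements is a copy of ℤ. -/
theorem exists_orderIso_int {S : Set ℤ} (hne : S.Nonempty) (hup : ∀ x ∈ S, ∃ y ∈ S, x < y)
    (hdown : ∀ x ∈ S, ∃ y ∈ S, y < x) : Nonempty (ℤ ≃o S) := by
  have : Nonempty S := hne.to_subtype
  have : NoMaxOrder S := ⟨fun x => let ⟨y, hy, h⟩ := hup x x.2; ⟨⟨y, hy⟩, h⟩⟩
  have : NoMinOrder S := ⟨fun x => let ⟨y, hy, h⟩ := hdown x x.2; ⟨⟨y, hy⟩, h⟩⟩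
  classical
  let _ : SuccOrder S := LinearLocallyFiniteOrder.succOrder S
  let _ : PredOrder S := LinearLocallyFiniteOrder.predOrder S
  exact ⟨(orderIsoIntOfLinearSuccPredArch (ι := S)).symm⟩

/-- An increasing enumeration of the core which turns `liftZ` and the translation by the period
into translations of the index. -/
structure Coding (p q r M : ℤ) where
  σ : ℤ → ℤ
  s : ℤ
  k : ℤ
  s_pos : 0 < s
  mono : StrictMono σ
  mem_iff : ∀ x, x ∈ core p q r M ↔ ∃ i, σ i = x
  map_lift : ∀ i, liftZ p q r M (σ i) = σ (i + k)
  map_add : ∀ i, σ (i + s) = σ i + p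
  neg : σ (-1) < 0
  nonneg : 0 ≤ σ 0

/-- Conjugated by `e`, the map becomes an order automorphism of ℤ, and these are translations. -/
theorem exists_index_translation {S : Set ℤ} (e : ℤ ≃o S) {f : S → S} (hf : StrictMono f)
    (hf' : Function.Surjective f) : ∃ k, ∀ i, f (e i) = e (i + k) := by
  let g : ℤ ≃o ℤ := (e.trans (hf.orderIsoOfSurjective f hf')).trans e.symm
  refine ⟨g 0, fun i => ?_⟩
  rw [← orderIso_int_apply g i]
  simp [g]

theorem exists_coding {p q r M : ℤ} (h : Admissible p q r) (hne : (core p q r M).Nonempty) :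
    Nonempty (Coding p q r M) := by
  have hp := h.pos
  have hadd : ∀ x ∈ core p q r M, x + p ∈ core p q r M := fun x hx => by
    have := add_mul_mem_core (x := x) (p := p) (q := q) (r := r) (M := M) (j := 1)
    rw [mul_one] at this
    exact this.mpr hx
  have hsub : ∀ x ∈ core p q r M, x - p ∈ core p q r M := fun x hx => by
    have := add_mul_mem_core (x := x - p) (p := p) (q := q) (r := r) (M := M) (j := 1)
    rw [mul_one, sub_add_cancel] at this
    exact this.mp hx
  obtain ⟨e⟩ := exists_orderIso_int hne (fun x hx => ⟨x + p, hadd x hx, by omega⟩)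
    (fun x hx => ⟨x - p, hsub x hx, by omega⟩)
  obtain ⟨k, hk⟩ := exists_index_translation e
    (f := fun x => ⟨liftZ p q r M x, liftZ_mem_core x.2⟩)
    (fun x y hxy => liftZ_lt_liftZ h (x.2 0) (y.2 0) hxy)
    (fun y => by
      obtain ⟨x, hx, hxy⟩ := exists_liftZ_eq_of_mem_core h y.2
      exact ⟨⟨x, hx⟩, Subtype.ext hxy⟩)
  obtain ⟨s, hs⟩ := exists_index_translation e
    (f := fun x => ⟨(x : ℤ) + p, hadd x x.2⟩)
    (fun x y hxy => by
      have : (x : ℤ) < y := hxy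
      exact Subtype.mk_lt_mk.mpr (by omega))
    (fun y => ⟨⟨(y : ℤ) - p, hsub y y.2⟩, Subtype.ext (by simp)⟩)
  have hmono : StrictMono fun i => (e i : ℤ) := fun i j hij => e.strictMono hij
  obtain ⟨i, hi, hi'⟩ := exists_index_of_strictMono hmono 0
  have hk' : ∀ i, liftZ p q r M (e i) = e (i + k) := fun i => congrArg Subtype.val (hk i)
  have hs' : ∀ i, (e i : ℤ) + p = e (i + s) := fun i => congrArg Subtype.val (hs i)
  -- The shift by i + 1 places the origin in the gap of index -1.
  refine ⟨⟨fun j => e (i + 1 + j), s, k, ?_, ?_, ?_, ?_, ?_, ?_, ?_⟩⟩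
  · have := hs' 0
    have : (e 0 : ℤ) < e (0 + s) := by omega
    have := hmono.lt_iff_lt.mp this
    omega
  · exact fun a b hab => hmono (by omega)
  · refine fun x => ⟨fun hx => ⟨e.symm ⟨x, hx⟩ - (i + 1), by simp⟩, ?_⟩
    rintro ⟨j, rfl⟩
    exact (e _).2
  · intro j
    simp only [hk', add_assoc]
  · intro j
    simp only [hs', add_assoc]
  · simpa using hi
  · simpa using hi'


/-! ### How the rotation changes the gaps -/

namespace Coding

variable {p q r M : ℤ} (C : Coding p q r M)

theorem map_add_mul (i j : ℤ) : C.σ (i + C.s * j) = C.σ i + p * j := by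
  induction j using Int.induction_on with
  | zero => simp
  | succ j ih =>
    rw [mul_add, mul_one, ← add_assoc, C.map_add, ih]; ring
  | pred j ih =>
    have := C.map_add (i + C.s * (-j - 1))
    rw [show i + C.s * (-(j : ℤ) - 1) + C.s = i + C.s * -j by ring, ih] at this
    linear_combination -this

theorem lift_iterate (i : ℤ) (n : ℕ) : (liftZ p q r M)^[n] (C.σ i) = C.σ (i + n * C.k) := by
  induction n generalizing i with
  | zero => simp
  | succ n ih =>
    rw [Function.iterate_succ_apply, C.map_lift, ih]
    congr 1
    push_cast
    ring

theorem mem_core (i : ℤ) : C.σ i ∈ core p q r M := (C.mem_iff _).mpr ⟨i, rfl⟩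

/-- Used with e = ±1: a core orbit that can be displaced rigidly without entering the hole yields
another core orbit. -/
theorem add_mem_core {e i : ℤ} (h : ∀ n : ℕ, ¬ InHole p q r (C.σ (i + n * C.k) + e) ∧
    liftZ p q r M (C.σ (i + n * C.k) + e) = C.σ (i + n * C.k + C.k) + e) :
    C.σ i + e ∈ core p q r M := by
  have key : ∀ n : ℕ, (liftZ p q r M)^[n] (C.σ i + e) = C.σ (i + n * C.k) + e := by
    intro n
    induction n with
    | zero => simp
    | succ n ih =>
      rw [Function.iterate_succ_apply', ih, (h n).2]
      congr 2
      push_cast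
      ring
  intro n
  rw [key]
  exact (h n).1

theorem exists_eq_mul_add (i : ℤ) : ∃ j i', i = i' + C.s * j ∧ 0 ≤ i' ∧ i' < C.s :=
  ⟨i / C.s, i % C.s, (Int.emod_add_mul_ediv i C.s).symm, Int.emod_nonneg _ C.s_pos.ne',
    Int.emod_lt_of_pos _ C.s_pos⟩

theorem notMem_core_of_mem_Ioo {i x : ℤ} (h₁ : C.σ i < x) (h₂ : x < C.σ (i + 1)) :
    x ∉ core p q r M := by
  rw [C.mem_iff]
  rintro ⟨j, rfl⟩
  have := C.mono.lt_iff_lt.mp h₁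
  have := C.mono.lt_iff_lt.mp h₂
  omega

/-- The black hole `[r + p - q, r)` lies in the gap after the element of index `i`. -/
def IsSplit (i : ℤ) : Prop := C.σ i < r + p - q ∧ r ≤ C.σ (i + 1)

variable {C}
variable {i₁ : ℤ}

theorem exists_isSplit (h : Admissible p q r) : ∃ i, C.IsSplit i := by
  obtain ⟨i, hi, hi'⟩ := exists_index_of_strictMono C.mono r
  refine ⟨i, ?_, hi'⟩
  by_contra hc
  exact C.mem_core i 0 (inHole_of_mem h (j := 0) (by simpa using hc) (by simpa using hi))

theorem σ_neg_one : C.σ (C.s - 1) = C.σ (-1) + p := by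
  rw [← C.map_add]; congr 1; ring

theorem σ_s : C.σ C.s = C.σ 0 + p := by
  rw [← C.map_add]; congr 1; ring

theorem IsSplit.neg_one_le (hi : C.IsSplit i₁) (h : Admissible p q r) : -1 ≤ i₁ := by
  by_contra hc
  have h1 := C.mono.monotone (show i₁ + 1 ≤ -1 by omega)
  have h2 := hi.2
  have := h.lt; have := h.sub_lt; have := C.neg
  omega

theorem IsSplit.lt_s (hi : C.IsSplit i₁) (h : Admissible p q r) : i₁ < C.s := by
  by_contra hc
  have h1 := C.mono.monotone (show C.s ≤ i₁ by omega)
  have h2 := hi.1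
  rw [σ_s] at h1
  have := h.lt; have := h.lt'; have := C.nonneg
  omega

theorem left_bounds (C : Coding p q r M) {i₁ i : ℤ} (h0 : 0 ≤ i) (h1 : i ≤ i₁) :
    C.σ 0 ≤ C.σ i ∧ C.σ i ≤ C.σ i₁ :=
  ⟨C.mono.monotone h0, C.mono.monotone h1⟩

theorem right_bounds (C : Coding p q r M) {i₁ i : ℤ} (h0 : i₁ < i) (h1 : i < C.s) :
    C.σ (i₁ + 1) ≤ C.σ i ∧ C.σ i ≤ C.σ (-1) + p :=
  ⟨C.mono.monotone h0, by rw [← σ_neg_one]; exact C.mono.monotone (by omega)⟩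

theorem IsSplit.map_left (hi : C.IsSplit i₁) (h : Admissible p q r) {i : ℤ} (h0 : 0 ≤ i)
    (h1 : i ≤ i₁) : C.σ (i + C.k) = C.σ i + M * q + q := by
  have := C.left_bounds h0 h1
  have := C.nonneg
  have := hi.1
  rw [← C.map_lift, liftZ_left h (j := 0)] <;> omega

theorem IsSplit.map_right (hi : C.IsSplit i₁) (h : Admissible p q r) {i : ℤ} (h0 : i₁ < i)
    (h1 : i < C.s) : C.σ (i + C.k) = C.σ i + M * q + p := by
  have := C.right_bounds h0 h1
  have := C.neg
  have := hi.2
  rw [← C.map_lift, liftZ_right h (j := 0)] <;> omega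

/-- Away from the indices -1 and i₁ modulo s, the closed gap lies on one side of the hole within one
period, where `liftZ` is a single translation. -/
theorem IsSplit.translation (hi : C.IsSplit i₁) (h : Admissible p q r) {i : ℤ}
    (h0 : ¬ C.s ∣ i + 1) (h1 : ¬ C.s ∣ i - i₁) :
    ∃ e, ∀ x, C.σ i ≤ x → x ≤ C.σ (i + 1) → ¬ InHole p q r x ∧ liftZ p q r M x = x + e := by
  obtain ⟨j, i, rfl, hi0, his⟩ := C.exists_eq_mul_add i
  have h0' : i ≠ C.s - 1 := by rintro rfl; exact h0 ⟨j + 1, by ring⟩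
  have h1' : i ≠ i₁ := by rintro rfl; exact h1 ⟨j, by ring⟩
  rw [add_right_comm]
  simp only [C.map_add_mul]
  rcases lt_or_gt_of_ne h1' with hlt | hlt
  · have b1 := C.left_bounds hi0 hlt.le
    have b2 := C.left_bounds (i₁ := i₁) (i := i + 1) (by omega) (by omega)
    have := C.nonneg
    have := hi.1
    refine ⟨M * q + q, fun x hx hx' => ⟨?_, ?_⟩⟩
    · exact not_inHole_left h (j := j) (by omega) (by omega)
    · rw [liftZ_left h (j := j) (by omega) (by omega)]; ring
  · have b1 := C.right_bounds hlt his
    have b2 := C.right_bounds (i₁ := i₁) (i := i + 1) (by omega) (by omega)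
    have := C.neg
    have := hi.2
    refine ⟨M * q + p, fun x hx hx' => ⟨?_, ?_⟩⟩
    · exact not_inHole_right h (j := j) (by omega) (by omega)
    · rw [liftZ_right h (j := j) (by omega) (by omega)]; ring

/-- If there were room to the right of both σ(-1) and σ(i₁), displacing all core points by +1 would
commute with `liftZ` and avoid the hole, so a gap would contain a core point. `right_end` is the
mirror image, with displacement -1. -/
theorem IsSplit.left_end (hi : C.IsSplit i₁) (h : Admissible p q r) (h0 : C.σ (-1) ≠ -1) :
    C.σ i₁ = r + p - q - 1 := by
  by_contra h1
  have key : C.σ i₁ + 1 ∈ core p q r M := by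
    refine C.add_mem_core fun n => ?_
    generalize i₁ + n * C.k = i
    obtain ⟨j, i, rfl, hi0, his⟩ := C.exists_eq_mul_add i
    have hn := C.neg
    have hnn := C.nonneg
    have b1 := hi.1
    have b2 := hi.2
    rw [add_right_comm, C.map_add_mul, C.map_add_mul]
    rcases le_or_gt i i₁ with hlt | hlt
    · have := C.left_bounds hi0 hlt
      rw [hi.map_left h hi0 hlt]
      refine ⟨not_inHole_left h (j := j) (by omega) (by omega), ?_⟩
      rw [liftZ_left h (j := j) (by omega) (by omega)]; ring
    · have := C.right_bounds hlt his
      rw [hi.map_right h hlt his]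
      refine ⟨not_inHole_right h (j := j) (by omega) (by omega), ?_⟩
      rw [liftZ_right h (j := j) (by omega) (by omega)]; ring
  have := h.lt; have := hi.1; have := hi.2
  exact C.notMem_core_of_mem_Ioo (i := i₁) (by omega) (by omega) key

theorem IsSplit.right_end (hi : C.IsSplit i₁) (h : Admissible p q r) (h0 : C.σ 0 ≠ 0) :
    C.σ (i₁ + 1) = r := by
  by_contra h1
  have key : C.σ (i₁ + 1) + (-1) ∈ core p q r M := by
    refine C.add_mem_core fun n => ?_
    generalize i₁ + 1 + n * C.k = i
    obtain ⟨j, i, rfl, hi0, his⟩ := C.exists_eq_mul_add i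
    have hn := C.neg
    have hnn := C.nonneg
    have b1 := hi.1
    have b2 := hi.2
    rw [add_right_comm, C.map_add_mul, C.map_add_mul]
    rcases le_or_gt i i₁ with hlt | hlt
    · have := C.left_bounds hi0 hlt
      rw [hi.map_left h hi0 hlt]
      refine ⟨not_inHole_left h (j := j) (by omega) (by omega), ?_⟩
      rw [liftZ_left h (j := j) (by omega) (by omega)]; ring
    · have := C.right_bounds hlt his
      rw [hi.map_right h hlt his]
      refine ⟨not_inHole_right h (j := j) (by omega) (by omega), ?_⟩
      rw [liftZ_right h (j := j) (by omega) (by omega)]; ring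
  have := h.lt; have := hi.1; have := hi.2
  exact C.notMem_core_of_mem_Ioo (i := i₁) (by omega) (by omega) key

theorem IsSplit.length_add (hi : C.IsSplit i₁) (h : Admissible p q r) {i : ℤ}
    (h0 : ¬ C.s ∣ i + 1) (h1 : ¬ C.s ∣ i - i₁) :
    C.σ (i + C.k + 1) - C.σ (i + C.k) = C.σ (i + 1) - C.σ i := by
  obtain ⟨e, he⟩ := hi.translation h h0 h1
  have hle := C.mono.monotone (show i ≤ i + 1 by omega)
  have e1 := (he _ le_rfl hle).2
  have e2 := (he _ hle le_rfl).2
  rw [C.map_lift] at e1 e2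
  rw [add_right_comm] at e2
  omega

theorem IsSplit.iterate_translation (hi : C.IsSplit i₁) (h : Admissible p q r) {i : ℤ} {n : ℕ}
    (hn : ∀ m < n, ¬ C.s ∣ i + m * C.k + 1 ∧ ¬ C.s ∣ i + m * C.k - i₁) {x : ℤ}
    (hx : C.σ i ≤ x) (hx' : x ≤ C.σ (i + 1)) :
    (∀ m < n, ¬ InHole p q r ((liftZ p q r M)^[m] x)) ∧
      (liftZ p q r M)^[n] x = x + (C.σ (i + n * C.k) - C.σ i) ∧
      C.σ (i + n * C.k + 1) - C.σ (i + n * C.k) = C.σ (i + 1) - C.σ i := by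
  induction n with
  | zero => simp
  | succ n ih =>
    obtain ⟨ih1, ih2, ih3⟩ := ih fun m hm => hn m (by omega)
    obtain ⟨h0, h1⟩ := hn n (by omega)
    obtain ⟨e, he⟩ := hi.translation h h0 h1
    have hle := C.mono.monotone (show i + n * C.k ≤ i + n * C.k + 1 by omega)
    have e1 := (he _ le_rfl hle).2
    have e2 := he ((liftZ p q r M)^[n] x) (by omega) (by omega)
    have e3 := hi.length_add h h0 h1
    have hk : i + ((n + 1 : ℕ) : ℤ) * C.k = i + n * C.k + C.k := by push_cast; ring
    rw [C.map_lift] at e1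
    rw [hk, Function.iterate_succ_apply']
    refine ⟨fun m hm => ?_, by omega, by omega⟩
    rcases Nat.lt_succ_iff_lt_or_eq.mp hm with hm | rfl
    · exact ih1 m hm
    · exact e2.1

/-- Conservation of length: the gap at the origin is widened by q - p, only the hole can undo this,
and after s steps the rotation is the identity. -/
theorem IsSplit.exists_hit (hi : C.IsSplit i₁) (h : Admissible p q r) :
    ∃ n : ℕ, 1 ≤ n ∧ C.s ∣ n * C.k - (i₁ + 1) ∧
      ∀ m : ℕ, 1 ≤ m → m < n → ¬ C.s ∣ m * C.k ∧ ¬ C.s ∣ m * C.k - (i₁ + 1) := by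
  have hs := C.s_pos
  have hcast : ((C.s.toNat : ℕ) : ℤ) = C.s := Int.toNat_of_nonneg hs.le
  have hex : ∃ n : ℕ, 1 ≤ n ∧ C.s ∣ n * C.k - (i₁ + 1) := by
    by_contra hc
    push Not at hc
    -- Otherwise n = s would be a hit; this rules out i₁ = -1 and i₁ = s - 1.
    have hi1 : ¬ C.s ∣ i₁ + 1 := by
      intro hd
      refine hc C.s.toNat (by omega) ?_
      rw [hcast]
      exact dvd_sub (dvd_mul_right _ _) hd
    have g1 := hi.neg_one_le h
    have g2 := hi.lt_s h
    have g3 : i₁ ≠ -1 := by rintro rfl; simp at hi1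
    have g4 : i₁ ≠ C.s - 1 := by rintro rfl; simp at hi1
    have e1 := hi.map_right h (i := C.s - 1) (by omega) (by omega)
    have e2 := hi.map_left h (i := 0) (by omega) (by omega)
    have hsub := C.map_add (-1 + C.k)
    rw [show -1 + C.k + C.s = C.s - 1 + C.k by ring, e1, σ_neg_one] at hsub
    rw [zero_add] at e2
    have key : ∀ n : ℕ, C.σ 0 - C.σ (-1) <
        C.σ (-1 + (n + 1 : ℕ) * C.k + 1) - C.σ (-1 + (n + 1 : ℕ) * C.k) := by
      intro n
      induction n with
      | zero =>
        have := h.lt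
        simp only [zero_add, Nat.cast_one, one_mul, neg_add_cancel_comm]
        omega
      | succ n ih =>
        have hk : -1 + ((n + 1 + 1 : ℕ) : ℤ) * C.k = -1 + (n + 1 : ℕ) * C.k + C.k := by
          push_cast; ring
        rw [hk]
        have hc' := hc (n + 1) (by omega)
        by_cases hd : C.s ∣ ((n + 1 : ℕ) : ℤ) * C.k
        · obtain ⟨t, ht⟩ := hd
          have f1 : -1 + ((n + 1 : ℕ) : ℤ) * C.k + C.k + 1 = C.k + C.s * t := by rw [ht]; ring
          have f2 : -1 + ((n + 1 : ℕ) : ℤ) * C.k + C.k = -1 + C.k + C.s * t := by rw [ht]; ring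
          rw [f1, f2, C.map_add_mul, C.map_add_mul]
          have := h.lt
          omega
        · rw [hi.length_add h]
          · exact ih
          · rwa [show -1 + ((n + 1 : ℕ) : ℤ) * C.k + 1 = (n + 1 : ℕ) * C.k by ring]
          · rwa [show -1 + ((n + 1 : ℕ) : ℤ) * C.k - i₁ = (n + 1 : ℕ) * C.k - (i₁ + 1) by ring]
    have := key (C.s.toNat - 1)
    rw [Nat.sub_add_cancel (by omega), hcast, add_right_comm, C.map_add_mul, C.map_add_mul,
      neg_add_cancel] at this
    omega
  classical
  obtain ⟨N, ⟨hN, hN'⟩, hmin⟩ : ∃ N : ℕ, (1 ≤ N ∧ C.s ∣ N * C.k - (i₁ + 1)) ∧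
      ∀ m < N, ¬ (1 ≤ m ∧ C.s ∣ m * C.k - (i₁ + 1)) :=
    ⟨Nat.find hex, Nat.find_spec hex, fun m hm => Nat.find_min hex hm⟩
  -- A return to the origin at time m < N would make N - m an earlier hit.
  refine ⟨N, hN, hN', fun m hm hm' => ⟨fun hd => ?_, fun hd => hmin m hm' ⟨hm, hd⟩⟩⟩
  refine hmin (N - m) (by omega) ⟨by omega, ?_⟩
  have := dvd_sub hN' hd
  rwa [Nat.cast_sub hm'.le, show ((N : ℤ) - m) * C.k - (i₁ + 1) =
    N * C.k - (i₁ + 1) - m * C.k by ring]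

/-- The lengths `δ` and `-δ'` by which the gap around the black hole exceeds the black hole, and
the position of the gaps at the origin and after one step. -/
theorem IsSplit.exists_delta (hi : C.IsSplit i₁) (h : Admissible p q r) :
    ∃ δ δ' : ℤ, 0 ≤ δ ∧ δ ≤ r + p - q ∧ r - p ≤ δ' ∧ δ' ≤ 0 ∧ (δ = 0 ∨ δ' = 0) ∧
      C.σ i₁ = r + p - q - δ - 1 ∧ C.σ (i₁ + 1) = r - δ' ∧
      C.σ (-1 + C.k) = M * q + p + δ' - 1 ∧ C.σ C.k = M * q + q + δ ∧
      ((-1 < i₁ ∧ i₁ < C.s - 1 ∧ C.σ (-1) = δ' - 1 ∧ C.σ 0 = δ) ∨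
        (i₁ = -1 ∧ δ = r + p - q ∧ δ' = 0) ∨ (i₁ = C.s - 1 ∧ δ = 0 ∧ δ' = r - p)) := by
  have g1 := hi.neg_one_le h
  have g2 := hi.lt_s h
  have b1 := hi.1
  have b2 := hi.2
  have hn := C.neg
  have hnn := C.nonneg
  have hle := hi.left_end h
  have hre := hi.right_end h
  have := h.lt; have := h.sub_lt; have := h.lt'
  have hs := C.s_pos
  have hsub : C.σ (-1 + C.k) = C.σ (C.s - 1 + C.k) - p := by
    have := C.map_add (-1 + C.k)
    rw [show -1 + C.k + C.s = C.s - 1 + C.k by ring] at this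
    omega
  have h0k : C.σ C.k = C.σ (0 + C.k) := by rw [zero_add]
  have hs1 := σ_neg_one (C := C)
  have hs0 := σ_s (C := C)
  refine ⟨r + p - q - 1 - C.σ i₁, r - C.σ (i₁ + 1), ?_⟩
  -- For i₁ = -1 and i₁ = s - 1 the hole and a translate of the origin share one gap, whose ends are
  -- fixed by `left_end` and `right_end`.
  rcases eq_or_lt_of_le g1 with rfl | g1
  · have e1 := hi.map_right h (i := C.s - 1) (by omega) (by omega)
    have e2 := hi.map_right h (i := 0) (by omega) (by omega)
    rw [neg_add_cancel] at *
    omega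
  · rcases eq_or_lt_of_le (show i₁ ≤ C.s - 1 by omega) with rfl | g2
    · have e1 := hi.map_left h (i := C.s - 1) (by omega) (by omega)
      have e2 := hi.map_left h (i := 0) (by omega) (by omega)
      rw [sub_add_cancel] at *
      omega
    · have e1 := hi.map_right h (i := C.s - 1) (by omega) (by omega)
      have e2 := hi.map_left h (i := 0) (by omega) (by omega)
      have l1 := C.mono.monotone (show 0 ≤ i₁ by omega)
      have l2 := C.mono.monotone (show i₁ + 1 ≤ C.s - 1 by omega)
      rw [zero_add] at e2
      -- The widened origin gap travels unchanged to the hole, so σ(0) - σ(-1) = δ - δ' + 1.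
      -- Together with `hle` and `hre` this determines both ends of the origin gap and makes δ or δ'
      -- vanish.
      obtain ⟨n, hn1, ⟨t, ht⟩, hn⟩ := hi.exists_hit h
      have hlen := (hi.iterate_translation h (i := -1 + C.k) (n := n - 1) (x := C.σ (-1 + C.k))
        (fun m hm => by
          have := hn (m + 1) (by omega) (by omega)
          push_cast at this
          rw [show -1 + C.k + m * C.k + 1 = (m + 1) * C.k by ring,
            show -1 + C.k + m * C.k - i₁ = (m + 1) * C.k - (i₁ + 1) by ring]
          exact this) le_rfl (C.mono.monotone (by omega))).2.2
      have f1 : -1 + C.k + ((n - 1 : ℕ) : ℤ) * C.k = i₁ + C.s * t := by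
        rw [← ht, Nat.cast_sub hn1]; push_cast; ring
      rw [f1, add_right_comm, C.map_add_mul, C.map_add_mul, neg_add_cancel_comm] at hlen
      omega

end Coding

/-! ### Arithmetic of the rotation and periodic sets -/

/-- Here d = gcd(s, k) generates the subgroup of ℤ/s spanned by k, and L = s/d is its order; Bézout
supplies n. -/
theorem exists_order_factor {s : ℤ} (hs : 0 < s) (k : ℤ) : ∃ (L : ℕ) (d : ℤ), 0 < L ∧ 0 < d ∧
    s = L * d ∧ (∀ m : ℤ, s ∣ m * k ↔ (L : ℤ) ∣ m) ∧
    ∀ i : ℤ, d ∣ i ↔ ∃ n : ℕ, 1 ≤ n ∧ n ≤ L ∧ s ∣ i - n * k := by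
  have hd : 0 < Int.gcd s k := Int.gcd_pos_of_ne_zero_left _ hs.ne'
  obtain ⟨s', hs'⟩ := Int.gcd_dvd_left s k
  obtain ⟨k', hk'⟩ := Int.gcd_dvd_right s k
  have hcop : IsCoprime s' k' := by
    refine ⟨Int.gcdA s k, Int.gcdB s k, ?_⟩
    have hb := Int.gcd_eq_gcd_ab s k
    have hd' : (Int.gcd s k : ℤ) ≠ 0 := by omega
    apply mul_left_cancel₀ hd'
    conv_rhs => rw [mul_one, hb]
    linear_combination (-Int.gcdA s k) * hs' - Int.gcdB s k * hk'
  have hb := Int.gcd_eq_gcd_ab s k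
  generalize Int.gcdB s k = v at hb
  generalize Int.gcdA s k = u at hb
  generalize (Int.gcd s k) = d at *
  have hs'0 : 0 < s' := by
    by_contra hc
    have : (d : ℤ) * s' ≤ 0 := mul_nonpos_of_nonneg_of_nonpos (by omega) (by omega)
    omega
  lift s' to ℕ using hs'0.le
  have hd0 : (d : ℤ) ≠ 0 := by omega
  have hord : ∀ m : ℤ, s ∣ m * k ↔ (s' : ℤ) ∣ m := by
    intro m
    rw [hs', hk', mul_left_comm, mul_dvd_mul_iff_left hd0]
    exact ⟨fun h => hcop.dvd_of_dvd_mul_right h, fun h => h.mul_right _⟩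
  refine ⟨s', d, by omega, by omega, by rw [hs', mul_comm], hord, fun i => ⟨?_, ?_⟩⟩
  · rintro ⟨e, rfl⟩
    have hL : (0 : ℤ) < s' := hs'0
    refine ⟨((v * e - 1) % s' + 1).toNat, ?_, ?_, ?_⟩
    · have := Int.emod_nonneg (v * e - 1) hL.ne'
      omega
    · have := Int.emod_lt_of_pos (v * e - 1) hL
      omega
    · have h0 := Int.emod_nonneg (v * e - 1) hL.ne'
      rw [Int.toNat_of_nonneg (by omega)]
      have h1 : s ∣ (v * e - ((v * e - 1) % s' + 1)) * k := by
        rw [hord]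
        exact ⟨(v * e - 1) / s', by rw [Int.emod_def]; ring⟩
      have h2 : d * e - ((v * e - 1) % s' + 1) * k =
          s * (u * e) + (v * e - ((v * e - 1) % s' + 1)) * k := by
        rw [hb]; ring
      rw [h2]
      exact dvd_add (dvd_mul_right _ _) h1
  · rintro ⟨n, -, -, hn⟩
    have h1 : (d : ℤ) ∣ s := ⟨_, hs'⟩
    have h2 : (d : ℤ) ∣ n * k := Dvd.dvd.mul_left ⟨_, hk'⟩ _
    have := dvd_add (h1.trans hn) h2
    rwa [sub_add_cancel] at this

/-- The union of the translates of `E` by the multiples of `p`. -/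
def periodize (p : ℤ) (E : Set ℤ) : Set ℤ := {x | ∃ j, x + p * j ∈ E}

section Periodize

variable {p q r M : ℤ}

theorem periodize_mono {E F : Set ℤ} (h : E ⊆ F) : periodize p E ⊆ periodize p F :=
  fun _ ⟨j, hj⟩ => ⟨j, h hj⟩

theorem periodize_union (E F : Set ℤ) : periodize p (E ∪ F) = periodize p E ∪ periodize p F := by
  ext x
  simp [periodize, exists_or]

theorem periodize_Ico_add_mul (x y j : ℤ) :
    periodize p (Set.Ico (x + p * j) (y + p * j)) = periodize p (Set.Ico x y) := by
  ext z
  constructor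
  · rintro ⟨i, h₁, h₂⟩
    exact ⟨i - j, by rw [mul_sub]; omega, by rw [mul_sub]; omega⟩
  · rintro ⟨i, h₁, h₂⟩
    exact ⟨i + j, by rw [mul_add]; omega, by rw [mul_add]; omega⟩

theorem periodize_image_stepZ (n : ℕ) (E : Set ℤ) :
    periodize p ((stepZ p q r M)^[n] '' E) = periodize p ((liftZ p q r M)^[n] '' E) := by
  ext z
  constructor
  · rintro ⟨j, x, hx, hxz⟩
    obtain ⟨i, hi⟩ := exists_liftZ_iterate_eq p q r M x n
    exact ⟨j + i, x, hx, by rw [hi, hxz]; ring⟩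
  · rintro ⟨j, x, hx, hxz⟩
    obtain ⟨i, hi⟩ := exists_liftZ_iterate_eq p q r M x n
    exact ⟨j - i, x, hx, by linear_combination hxz - hi⟩

theorem image_stepZ_periodize (n : ℕ) (E : Set ℤ) :
    (stepZ p q r M)^[n] '' periodize p E = periodize p ((stepZ p q r M)^[n] '' E) := by
  ext z
  constructor
  · rintro ⟨x, ⟨j, hj⟩, rfl⟩
    exact ⟨j, _, hj, stepZ_iterate_add_mul n⟩
  · rintro ⟨j, x, hx, hxz⟩
    refine ⟨x + p * -j, ⟨j, by simpa using hx⟩, ?_⟩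
    rw [stepZ_iterate_add_mul, hxz]
    ring

theorem stepZ_iterate_of_inHole (n : ℕ) {x : ℤ} (hx : InHole p q r x) :
    (stepZ p q r M)^[n] x = x := by
  refine Function.iterate_fixed ?_ n
  rw [stepZ, if_neg (by exact not_lt.mpr hx.1), if_pos hx.2]

end Periodize

/-! ### The orbit of the gap at the origin -/

namespace Coding

variable {p q r M : ℤ} {C : Coding p q r M} {i₁ : ℤ} {n₀ L : ℕ} {d : ℤ}

/-- Combinatorial data of the orbit of the index `-1` under the translation by `k` modulo `s`:
it has length `L`, step `d` and meets the gap around the black hole first at time `n₀`. -/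
structure Orbit (C : Coding p q r M) (i₁ : ℤ) (n₀ L : ℕ) (d : ℤ) : Prop where
  split : C.IsSplit i₁
  one_le : 1 ≤ n₀
  le : n₀ ≤ L
  d_pos : 0 < d
  s_eq : C.s = L * d
  hit : C.s ∣ n₀ * C.k - (i₁ + 1)
  not_dvd : ∀ m : ℕ, 1 ≤ m → m < n₀ → ¬ C.s ∣ m * C.k ∧ ¬ C.s ∣ m * C.k - (i₁ + 1)
  dvd_iff : ∀ m : ℤ, C.s ∣ m * C.k ↔ (L : ℤ) ∣ m
  dvd_iff' : ∀ i : ℤ, d ∣ i ↔ ∃ n : ℕ, 1 ≤ n ∧ n ≤ L ∧ C.s ∣ i - n * C.k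

theorem exists_orbit (C : Coding p q r M) (h : Admissible p q r) :
    ∃ (i₁ : ℤ) (n₀ L : ℕ) (d : ℤ), C.Orbit i₁ n₀ L d := by
  obtain ⟨i₁, hi⟩ := C.exists_isSplit h
  obtain ⟨n₀, h1, h2, h3⟩ := hi.exists_hit h
  obtain ⟨L, d, hL, hd, hs, ho, ho'⟩ := exists_order_factor C.s_pos C.k
  refine ⟨i₁, n₀, L, d, hi, h1, ?_, hd, hs, h2, h3, ho, ho'⟩
  by_contra hc
  exact (h3 L hL (by omega)).1 ((ho L).mpr dvd_rfl)

/-- The periodization of the gap after the element of index `i`. -/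
def gap (C : Coding p q r M) (i : ℤ) : Set ℤ := periodize p (Set.Ioo (C.σ i) (C.σ (i + 1)))

theorem mem_gap {i x : ℤ} :
    x ∈ C.gap i ↔ ∃ j, C.σ (i + C.s * j) < x ∧ x < C.σ (i + C.s * j + 1) := by
  constructor
  · rintro ⟨j, h₁, h₂⟩
    refine ⟨-j, ?_⟩
    rw [add_right_comm, C.map_add_mul, C.map_add_mul, mul_neg]
    omega
  · rintro ⟨j, hj⟩
    rw [add_right_comm, C.map_add_mul, C.map_add_mul] at hj
    exact ⟨-j, by rw [mul_neg]; omega, by rw [mul_neg]; omega⟩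

theorem gap_congr {i i' : ℤ} (h : C.s ∣ i - i') : C.gap i = C.gap i' := by
  obtain ⟨t, ht⟩ := h
  obtain rfl : i = i' + C.s * t := by omega
  ext x
  simp only [mem_gap]
  constructor
  · rintro ⟨j, hj⟩
    exact ⟨t + j, by rw [mul_add, ← add_assoc]; exact hj⟩
  · rintro ⟨j, hj⟩
    refine ⟨j - t, ?_⟩
    rw [show i' + C.s * t + C.s * (j - t) = i' + C.s * j by ring]; exact hj

theorem notMem_core_of_mem_gap {i x : ℤ} (hx : x ∈ C.gap i) : x ∉ core p q r M := by
  obtain ⟨j, h₁, h₂⟩ := mem_gap.mp hx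
  exact C.notMem_core_of_mem_Ioo h₁ h₂

/-- A core point separates two different gaps; this one unit of room permits the enlargement by half
a unit on each side. -/
theorem two_le_of_mem_gap {i i' x y : ℤ} (h : ¬ C.s ∣ i - i') (hx : x ∈ C.gap i)
    (hy : y ∈ C.gap i') : 2 ≤ |x - y| := by
  obtain ⟨j, h₁, h₂⟩ := mem_gap.mp hx
  obtain ⟨j', h₁', h₂'⟩ := mem_gap.mp hy
  have hne : i + C.s * j ≠ i' + C.s * j' := fun he => h ⟨j' - j, by linear_combination he⟩
  rcases lt_or_gt_of_ne hne with hlt | hlt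
  · have := C.mono.monotone (show i + C.s * j + 1 ≤ i' + C.s * j' by omega)
    rw [le_abs]; omega
  · have := C.mono.monotone (show i' + C.s * j' + 1 ≤ i + C.s * j by omega)
    rw [le_abs]; omega

/-- Serves the case δ = δ' = 0, where the small gaps shrink to points: the half-unit neighborhood of
a point meets just the cells on its two sides. -/
theorem ne_of_mem_gap {i i' x j : ℤ} (h : ¬ C.s ∣ i - i') (hx : x ∈ C.gap i) :
    x ≠ C.σ (i' + 1) + p * j ∧ x ≠ C.σ (i' + 1) - 1 + p * j := by
  rw [sub_add_eq_add_sub, ← C.map_add_mul]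
  obtain ⟨j', h₁, h₂⟩ := mem_gap.mp hx
  have hne : i + C.s * j' ≠ i' + C.s * j := fun he => h ⟨j - j', by linear_combination he⟩
  rw [add_right_comm i' 1]
  rcases lt_or_gt_of_ne hne with hlt | hlt
  · have := C.mono.monotone (show i + C.s * j' + 1 ≤ i' + C.s * j by omega)
    have := C.mono (show i' + C.s * j < i' + C.s * j + 1 by omega)
    omega
  · have := C.mono.monotone (show i' + C.s * j + 1 ≤ i + C.s * j' by omega)
    omega

theorem IsSplit.image_Ioo (hi : C.IsSplit i₁) (h : Admissible p q r) {i : ℤ} {n : ℕ}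
    (hn : ∀ m < n, ¬ C.s ∣ i + m * C.k + 1 ∧ ¬ C.s ∣ i + m * C.k - i₁) :
    (liftZ p q r M)^[n] '' Set.Ioo (C.σ i) (C.σ (i + 1)) =
      Set.Ioo (C.σ (i + n * C.k)) (C.σ (i + n * C.k + 1)) := by
  have hle := C.mono.monotone (show i ≤ i + 1 by omega)
  have h3 := (hi.iterate_translation h hn le_rfl hle).2.2
  ext y
  constructor
  · rintro ⟨x, ⟨h₁, h₂⟩, rfl⟩
    have := (hi.iterate_translation h hn h₁.le h₂.le).2.1
    exact ⟨by omega, by omega⟩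
  · rintro ⟨h₁, h₂⟩
    refine ⟨y - (C.σ (i + n * C.k) - C.σ i), ⟨by omega, by omega⟩, ?_⟩
    rw [(hi.iterate_translation h hn (by omega) (by omega)).2.1]
    ring

namespace Orbit

variable (O : C.Orbit i₁ n₀ L d)
include O

theorem dvd_sub_iff {n n' : ℤ} {e : ℤ} :
    C.s ∣ (e + n * C.k) - (e + n' * C.k) ↔ (L : ℤ) ∣ n - n' := by
  rw [← O.dvd_iff, add_sub_add_left_eq_sub, sub_mul]

theorem L_pos : 1 ≤ L := O.one_le.trans O.le

theorem d_dvd_s : d ∣ C.s := ⟨L, by rw [O.s_eq, mul_comm]⟩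

theorem d_dvd_k : d ∣ C.k := by
  rw [O.dvd_iff']
  refine ⟨1, le_rfl, O.L_pos, by simp⟩

theorem d_dvd_split : d ∣ i₁ + 1 := by
  have := O.d_dvd_s.trans O.hit
  rwa [dvd_sub_right (O.d_dvd_k.mul_left _)] at this

theorem not_dvd_of_not_dvd {i : ℤ} (hi : ¬ d ∣ i + 1) (m : ℕ) :
    ¬ C.s ∣ i + m * C.k + 1 ∧ ¬ C.s ∣ i + m * C.k - i₁ := by
  constructor
  · intro hd
    have := dvd_sub (O.d_dvd_s.trans hd) (O.d_dvd_k.mul_left m)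
    rw [show i + m * C.k + 1 - m * C.k = i + 1 by ring] at this
    exact hi this
  · intro hd
    have := dvd_add (dvd_sub (O.d_dvd_s.trans hd) (O.d_dvd_k.mul_left m)) O.d_dvd_split
    rw [show i + m * C.k - i₁ - m * C.k + (i₁ + 1) = i + 1 by ring] at this
    exact hi this

/-- Both -1 and i₁ are congruent to -1 modulo d, so such a gap meets neither the origin nor the hole
at any time. Its integers would be translated forever off the hole, hence be in the core. -/
theorem succ_eq (h : Admissible p q r) {i : ℤ} (hi : ¬ d ∣ i + 1) : C.σ (i + 1) = C.σ i + 1 := by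
  have hlt := C.mono (show i < i + 1 by omega)
  by_contra hne
  refine C.notMem_core_of_mem_Ioo (i := i) (x := C.σ i + 1) (by omega) (by omega) fun n => ?_
  exact (O.split.iterate_translation h (n := n + 1) (fun m _ => O.not_dvd_of_not_dvd hi m)
    (by omega) (by omega)).1 n (by omega)

theorem add_eq (h : Admissible p q r) {i : ℤ} (hi : d ∣ i) (e : ℕ) (he : e < d) :
    C.σ (i + e) = C.σ i + e := by
  induction e with
  | zero => simp
  | succ e ih =>
    have : C.σ (i + e + 1) = C.σ (i + e) + 1 := by
      refine O.succ_eq h fun hd => ?_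
      rw [add_assoc, dvd_add_right hi] at hd
      have := Int.le_of_dvd (by omega) hd
      push_cast at he
      omega
    push_cast
    rw [← add_assoc, this, ih (by push_cast at he; omega)]
    ring

theorem exists_of_gap_nonempty (h : Admissible p q r) {i : ℤ} (hi : (C.gap i).Nonempty) :
    ∃ n : ℕ, 1 ≤ n ∧ n ≤ L ∧ C.gap i = C.gap (-1 + n * C.k) := by
  have hd : d ∣ i + 1 := by
    by_contra hd
    obtain ⟨x, j, h₁, h₂⟩ := hi
    rw [O.succ_eq h hd] at h₂
    omega
  obtain ⟨n, h1, h2, h3⟩ := (O.dvd_iff' _).mp hd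
  refine ⟨n, h1, h2, gap_congr ?_⟩
  rwa [show i - (-1 + n * C.k) = i + 1 - n * C.k by ring]

theorem compl_core (h : Admissible p q r) {x : ℤ} :
    x ∉ core p q r M ↔ ∃ n : ℕ, 1 ≤ n ∧ n ≤ L ∧ x ∈ C.gap (-1 + n * C.k) := by
  refine ⟨fun hx => ?_, fun ⟨n, _, _, hn⟩ => notMem_core_of_mem_gap hn⟩
  obtain ⟨i, h₁, h₂⟩ := exists_index_of_strictMono C.mono x
  have hne : x ≠ C.σ (i + 1) := by rintro rfl; exact hx (C.mem_core _)
  have hg : x ∈ C.gap i := mem_gap.mpr ⟨0, by simpa using h₁, by simp; omega⟩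
  obtain ⟨n, h1, h2, h3⟩ := O.exists_of_gap_nonempty h ⟨x, hg⟩
  exact ⟨n, h1, h2, h3 ▸ hg⟩

theorem mem_core_iff (h : Admissible p q r) {x : ℤ} :
    x ∈ core p q r M ↔ ∃ n : ℕ, 1 ≤ n ∧ n ≤ L ∧
      x ∈ periodize p (Set.Ico (C.σ (n * C.k)) (C.σ (n * C.k) + d)) := by
  constructor
  · intro hx
    obtain ⟨i, rfl⟩ := (C.mem_iff x).mp hx
    have h0 := Int.emod_nonneg i O.d_pos.ne'
    have h1 := Int.emod_lt_of_pos i O.d_pos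
    have h2 := Int.emod_add_mul_ediv i d
    obtain ⟨n, hn1, hn2, t, ht⟩ := (O.dvd_iff' (d * (i / d))).mp (dvd_mul_right _ _)
    refine ⟨n, hn1, hn2, -t, ?_⟩
    have := O.add_eq h (i := n * C.k) (O.d_dvd_k.mul_left _) (i % d).toNat (by omega)
    rw [Int.toNat_of_nonneg h0] at this
    rw [← C.map_add_mul, show i + C.s * -t = n * C.k + i % d by linear_combination -h2 + ht, this]
    exact ⟨by omega, by omega⟩
  · rintro ⟨n, -, -, j, h₁, h₂⟩
    have := O.add_eq h (i := n * C.k) (O.d_dvd_k.mul_left _) (x + p * j - C.σ (n * C.k)).toNat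
      (by omega)
    rw [Int.toNat_of_nonneg (by omega), add_sub_cancel] at this
    rw [← add_mul_mem_core (j := j), ← this]
    exact C.mem_core _

/-- A common point gives nk + e ≡ n'k + e' modulo s with 0 ≤ e, e' < d. As d divides k and s, first
e = e', and then L divides n - n'. -/
theorem disjoint_blocks (h : Admissible p q r) {n n' : ℤ} (hn : ¬ (L : ℤ) ∣ n - n') :
    Disjoint (periodize p (Set.Ico (C.σ (n * C.k)) (C.σ (n * C.k) + d)))
      (periodize p (Set.Ico (C.σ (n' * C.k)) (C.σ (n' * C.k) + d))) := by
  have key : ∀ (n : ℤ) x, x ∈ periodize p (Set.Ico (C.σ (n * C.k)) (C.σ (n * C.k) + d)) →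
      ∃ j e, 0 ≤ e ∧ e < d ∧ x = C.σ (n * C.k + e + C.s * j) := by
    rintro n x ⟨j, h₁, h₂⟩
    have := O.add_eq h (i := n * C.k) (O.d_dvd_k.mul_left _) (x + p * j - C.σ (n * C.k)).toNat
      (by omega)
    rw [Int.toNat_of_nonneg (by omega), add_sub_cancel] at this
    exact ⟨-j, x + p * j - C.σ (n * C.k), by omega, by omega, by rw [C.map_add_mul, this]; ring⟩
  rw [Set.disjoint_left]
  intro x hx hx'
  obtain ⟨j, e, he0, hed, rfl⟩ := key n x hx
  obtain ⟨j', e', he0', hed', he⟩ := key n' _ hx'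
  have he := C.mono.injective he
  obtain ⟨a, ha⟩ := O.d_dvd_k
  obtain ⟨b, hb⟩ := O.d_dvd_s
  have hdvd : d ∣ e - e' := ⟨n' * a - n * a + b * (j' - j), by
    linear_combination he + (n' - n) * ha + (j' - j) * hb⟩
  have hee : e - e' = 0 := Int.eq_zero_of_abs_lt_dvd hdvd (by rw [abs_lt]; omega)
  refine hn ((O.dvd_sub_iff (e := 0)).mp ⟨j' - j, by linear_combination he - hee⟩)

theorem hit_congr (m : ℤ) : C.s ∣ (-1 + (n₀ + m) * C.k) - (i₁ + m * C.k) := by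
  rw [show (-1 + (n₀ + m) * C.k) - (i₁ + m * C.k) = n₀ * C.k - (i₁ + 1) by ring]
  exact O.hit

/-- Detects the degenerate case in which the hole and the origin share a gap, so that no small gaps
occur. -/
theorem dvd_split_iff : C.s ∣ i₁ + 1 ↔ n₀ = L := by
  have h1 : C.s ∣ i₁ + 1 ↔ C.s ∣ n₀ * C.k := by
    have := (dvd_sub_comm.mp O.hit)
    constructor
    · intro hd
      simpa using dvd_add O.hit hd
    · intro hd
      simpa using dvd_add this hd
  rw [h1, O.dvd_iff]
  constructor
  · intro hd
    have := Int.le_of_dvd (by have := O.one_le; omega) hd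
    have := O.le
    omega
  · rintro rfl
    exact dvd_rfl

theorem not_dvd_after {m : ℕ} (h1 : 1 ≤ m) (h2 : m < L - n₀) :
    ¬ C.s ∣ i₁ + m * C.k + 1 ∧ ¬ C.s ∣ i₁ + m * C.k - i₁ := by
  have key : ∀ m : ℕ, 1 ≤ m → m < L → ¬ C.s ∣ m * C.k := by
    intro m h1 h2 hd
    have := Int.le_of_dvd (by omega) ((O.dvd_iff _).mp hd)
    omega
  constructor
  · intro hd
    refine key (n₀ + m) (by omega) (by omega) ?_
    have := dvd_add O.hit hd
    push_cast
    rwa [show n₀ * C.k - (i₁ + 1) + (i₁ + m * C.k + 1) = (n₀ + m) * C.k by ring] at this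
  · rw [add_sub_cancel_left]
    exact key m h1 (by omega)

theorem not_dvd_before {m : ℕ} (h2 : m + 1 < n₀) :
    ¬ C.s ∣ -1 + C.k + m * C.k + 1 ∧ ¬ C.s ∣ -1 + C.k + m * C.k - i₁ := by
  have := O.not_dvd (m + 1) (by omega) h2
  push_cast at this
  rw [show -1 + C.k + m * C.k + 1 = (m + 1) * C.k by ring,
    show -1 + C.k + m * C.k - i₁ = (m + 1) * C.k - (i₁ + 1) by ring]
  exact this

/-- The gaps keep their length along the orbit until the black hole is met. -/
theorem length_before (h : Admissible p q r) {m : ℕ} (h1 : m + 1 ≤ n₀) :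
    C.σ (-1 + (m + 1) * C.k + 1) - C.σ (-1 + (m + 1) * C.k) =
      C.σ C.k - C.σ (-1 + C.k) := by
  have := (O.split.iterate_translation h (i := -1 + C.k) (n := m) (x := C.σ (-1 + C.k))
    (fun i hi => O.not_dvd_before (by omega)) le_rfl (C.mono.monotone (by omega))).2.2
  rw [show -1 + C.k + m * C.k = -1 + (m + 1) * C.k by ring] at this
  rw [this, neg_add_cancel_comm]

theorem length_after (h : Admissible p q r) {m : ℕ} (h1 : m + 1 ≤ L - n₀) :
    C.σ (-1 + (n₀ + (m + 1)) * C.k + 1) - C.σ (-1 + (n₀ + (m + 1)) * C.k) =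
      C.σ (i₁ + C.k + 1) - C.σ (i₁ + C.k) := by
  have := (O.split.iterate_translation h (i := i₁ + C.k) (n := m) (x := C.σ (i₁ + C.k))
    (fun i hi => by
      have := O.not_dvd_after (m := i + 1) (by omega) (by omega)
      push_cast at this
      rwa [show i₁ + C.k + i * C.k = i₁ + (i + 1) * C.k by ring])
      le_rfl (C.mono.monotone (by omega))).2.2
  obtain ⟨t, ht⟩ := O.hit_congr (m + 1)
  rw [show -1 + (n₀ + (m + 1)) * C.k = i₁ + C.k + m * C.k + C.s * t by linear_combination ht,
    add_right_comm, C.map_add_mul, C.map_add_mul]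
  linarith

/-- A period consists of s core points and the gaps after them. Only gaps with d ∣ i + 1 contribute,
and the orbit of -1 visits each of these once. -/
theorem sum_length (h : Admissible p q r) :
    p = C.s + ∑ n ∈ Finset.range L,
      (C.σ (-1 + (n + 1) * C.k + 1) - C.σ (-1 + (n + 1) * C.k) - 1) := by
  have hs := C.s_pos
  let φ : ℤ → ℤ := fun i => C.σ (i + 1) - C.σ i - 1
  have hφ : ∀ i j, C.s ∣ i - j → φ i = φ j := by
    rintro i j ⟨t, ht⟩
    obtain rfl : i = j + C.s * t := by omega
    simp only [φ]
    rw [add_right_comm, C.map_add_mul, C.map_add_mul]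
    ring
  have hmod : ∀ i : ℤ, (((i % C.s).toNat : ℕ) : ℤ) = i % C.s := fun i =>
    Int.toNat_of_nonneg (Int.emod_nonneg _ hs.ne')
  have hsc : ((C.s.toNat : ℕ) : ℤ) = C.s := Int.toNat_of_nonneg hs.le
  have hdm : ∀ i : ℤ, C.s ∣ i % C.s - i := fun i => by
    rw [Int.emod_def]; exact ⟨-(i / C.s), by ring⟩
  have htot : ∑ i ∈ Finset.range C.s.toNat, φ (i : ℤ) = p - C.s := by
    have : ∀ n : ℕ, ∑ i ∈ Finset.range n, φ (i : ℤ) = C.σ n - C.σ 0 - n := by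
      intro n
      induction n with
      | zero => simp
      | succ n ih => rw [Finset.sum_range_succ, ih]; simp only [φ]; push_cast; ring
    rw [this, hsc, σ_s]
    ring
  let g : ℕ → ℕ := fun n => ((-1 + ((n : ℤ) + 1) * C.k) % C.s).toNat
  have hg : ∀ n, C.s ∣ (g n : ℤ) - (-1 + ((n : ℤ) + 1) * C.k) := fun n => by
    simp only [g]
    rw [hmod]; exact hdm _
  have hinj : Set.InjOn g (Finset.range L : Set ℕ) := by
    intro n hn n' hn' he
    have h1 := dvd_sub (hg n') (hg n)
    rw [he, sub_sub_sub_cancel_left, O.dvd_sub_iff] at h1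
    simp only [Finset.coe_range, Set.mem_Iio] at hn hn'
    have := Int.eq_zero_of_abs_lt_dvd h1 (by rw [abs_lt]; omega)
    omega
  have himg : (Finset.range L).image g ⊆ Finset.range C.s.toNat := by
    intro i hi
    obtain ⟨n, -, rfl⟩ := Finset.mem_image.mp hi
    have := Int.emod_lt_of_pos (-1 + ((n : ℤ) + 1) * C.k) hs
    have := hmod (-1 + ((n : ℤ) + 1) * C.k)
    simp only [Finset.mem_range, g]
    omega
  have hzero : ∀ i ∈ Finset.range C.s.toNat, i ∉ (Finset.range L).image g → φ (i : ℤ) = 0 := by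
    intro i hi hni
    have : ¬ d ∣ (i : ℤ) + 1 := by
      intro hd
      obtain ⟨n, h1, h2, h3⟩ := (O.dvd_iff' _).mp hd
      refine hni (Finset.mem_image.mpr ⟨n - 1, by simp; omega, ?_⟩)
      have h4 := hg (n - 1)
      rw [Nat.cast_sub h1, Nat.cast_one, sub_add_cancel] at h4
      have h5 := dvd_sub h4 h3
      rw [show (g (n - 1) : ℤ) - (-1 + n * C.k) - (i + 1 - n * C.k) = g (n - 1) - i by ring] at h5
      have h6 := Finset.mem_range.mp (himg (Finset.mem_image_of_mem g
        (Finset.mem_range.mpr (show n - 1 < L by omega))))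
      have h7 := Finset.mem_range.mp hi
      have := Int.eq_zero_of_abs_lt_dvd h5 (by rw [abs_lt]; omega)
      omega
    simp only [φ]
    rw [O.succ_eq h this]
    ring
  rw [← Finset.sum_subset himg hzero, Finset.sum_image hinj] at htot
  have : ∑ n ∈ Finset.range L, (C.σ (-1 + (n + 1) * C.k + 1) - C.σ (-1 + (n + 1) * C.k) - 1) =
      ∑ n ∈ Finset.range L, φ (g n) :=
    Finset.sum_congr rfl fun n _ => (hφ _ _ (hg n)).symm
  rw [this, htot]
  ring

end Orbit
end Coding

/-! ### The gap structure theorem over the integers -/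

section Defs

variable (p q r M δ δ' : ℤ)

/-- The integer version of `bigGap`. -/
def bigGapZ (n : ℕ) : Set ℤ :=
  periodize p ((stepZ p q r M)^[n] '' Set.Ico (M * q + δ') (M * q + (q - p + δ)))

/-- The integer version of `smallGap`. -/
def smallGapZ (m : ℕ) : Set ℤ :=
  periodize p ((stepZ p q r M)^[m] ''
    (Set.Ico (r + p - q - δ) (r - δ') \ Set.Ico (r + p - q) r))

/-- The orbit of the right end point of the gap `bigGapZ 0`. -/
def endpoint (n : ℕ) : ℤ := (stepZ p q r M)^[n] (M * q + q - p + δ)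

/-- The structure of the core and of its gaps, in units of `b / q`. -/
structure GapStructure (w : ℤ) (N₁ N₂ : ℕ) : Prop where
  δ_nonneg : 0 ≤ δ
  δ_le : δ ≤ r + p - q
  le_δ' : r - p ≤ δ'
  δ'_nonpos : δ' ≤ 0
  mul_eq_zero : δ * δ' = 0
  big_eq : ∀ n ≤ N₁, bigGapZ p q r M δ δ' n =
    periodize p (Set.Ico (endpoint p q r M δ n + (p - q + δ' - δ)) (endpoint p q r M δ n))
  big_last : bigGapZ p q r M δ δ' N₁ = periodize p (Set.Ico (r + p - q - δ) (r - δ'))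
  endpoint_last : ∃ j, endpoint p q r M δ N₁ = r - δ' + p * j
  small_eq : ∀ m, 1 ≤ m → m ≤ N₂ → smallGapZ p q r M δ δ' m =
    periodize p (Set.Ico ((stepZ p q r M)^[m] (r - δ') + (δ' - δ)) ((stepZ p q r M)^[m] (r - δ')))
  small_last : smallGapZ p q r M δ δ' N₂ = periodize p (Set.Ico δ' δ)
  origin : δ = 0 → δ' = 0 → ∃ j, (stepZ p q r M)^[N₂] r = p * j
  sep_big : ∀ n ≤ N₁, ∀ n' ≤ N₁, n ≠ n' → ∀ x ∈ bigGapZ p q r M δ δ' n,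
    ∀ y ∈ bigGapZ p q r M δ δ' n', 2 ≤ |x - y|
  sep_small : ∀ m ∈ Set.Icc 1 N₂, ∀ m' ∈ Set.Icc 1 N₂, m ≠ m' →
    ∀ x ∈ smallGapZ p q r M δ δ' m, ∀ y ∈ smallGapZ p q r M δ δ' m', 2 ≤ |x - y|
  sep_mixed : ∀ n ≤ N₁, ∀ m ∈ Set.Icc 1 N₂,
    ∀ x ∈ bigGapZ p q r M δ δ' n, ∀ y ∈ smallGapZ p q r M δ δ' m, 2 ≤ |x - y|
  sep_point : ∀ m ∈ Set.Icc 1 N₂, ∀ m' ∈ Set.Icc 1 N₂, m ≠ m' →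
    ∀ j, (stepZ p q r M)^[m] (r - δ') ≠ (stepZ p q r M)^[m'] (r - δ') + p * j
  sep_big_point : ∀ n ≤ N₁, ∀ m ∈ Set.Icc 1 N₂, ∀ x ∈ bigGapZ p q r M δ δ' n, ∀ j,
    x ≠ (stepZ p q r M)^[m] (r - δ') + p * j ∧ x ≠ (stepZ p q r M)^[m] (r - δ') - 1 + p * j
  compl_eq : (core p q r M)ᶜ = (⋃ n ∈ Set.Icc 0 N₁, bigGapZ p q r M δ δ' n) ∪
    ⋃ m ∈ Set.Icc 1 N₂,
      periodize p ((stepZ p q r M)^[m] '' Set.Ico (r + p - q - δ) (r - δ'))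
  compl_eq' : (core p q r M)ᶜ = ⋃ n ∈ Set.Icc 0 (N₁ + N₂), bigGapZ p q r M δ δ' n
  w_pos : 0 < w
  core_eq : core p q r M = ⋃ n ∈ Set.Icc 0 (N₁ + N₂),
    periodize p (Set.Ico (endpoint p q r M δ n) (endpoint p q r M δ n + w))
  disjoint : ∀ n ≤ N₁ + N₂, ∀ n' ≤ N₁ + N₂, n ≠ n' →
    Disjoint (periodize p (Set.Ico (endpoint p q r M δ n) (endpoint p q r M δ n + w)))
      (periodize p (Set.Ico (endpoint p q r M δ n') (endpoint p q r M δ n' + w)))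
  count : ((N₁ : ℤ) + N₂ + 1) * (w + δ - δ') + (N₁ + 1) * (q - p) = p

end Defs

section

variable {p q r M : ℤ}

theorem periodize_image_congr {E F : Set ℤ} (h : periodize p E = periodize p F) (n : ℕ) :
    periodize p ((stepZ p q r M)^[n] '' E) = periodize p ((stepZ p q r M)^[n] '' F) := by
  rw [← image_stepZ_periodize, h, image_stepZ_periodize]

theorem exists_gapStructure (h : Admissible p q r) (hne : (core p q r M).Nonempty) :
    ∃ (δ δ' w : ℤ) (N₁ N₂ : ℕ), GapStructure p q r M δ δ' w N₁ N₂ := by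
  obtain ⟨C⟩ := exists_coding h hne
  obtain ⟨i₁, n₀, L, d, O⟩ := C.exists_orbit h
  obtain ⟨δ, δ', hδ0, hδ1, hδ2, hδ3, hδδ, hs1, hs2, hk1, hk2, hcase⟩ := O.split.exists_delta h
  have hpos := h.pos
  have hpq := h.lt; have hr1 := h.sub_lt; have hr2 := h.lt'
  have hn1 := O.one_le
  have hnL := O.le
  have hgen : n₀ < L → -1 < i₁ ∧ i₁ < C.s - 1 ∧ C.σ (-1) = δ' - 1 ∧ C.σ 0 = δ := by
    intro hlt
    rcases hcase with hc | ⟨rfl, -⟩ | ⟨rfl, -⟩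
    · exact hc
    · exact absurd (O.dvd_split_iff.mp (by simp)) hlt.ne
    · exact absurd (O.dvd_split_iff.mp (by simp)) hlt.ne
  have hspec : n₀ = L → (δ = r + p - q ∧ δ' = 0) ∨ (δ = 0 ∧ δ' = r - p) := by
    intro he
    have := O.dvd_split_iff.mpr he
    rcases hcase with ⟨g1, g2, -⟩ | ⟨-, hc⟩ | ⟨-, hc⟩
    · have := Int.le_of_dvd (by omega) this
      omega
    · exact .inl hc
    · exact .inr hc
  have hE : ∀ n : ℕ, ∃ j, endpoint p q r M δ n = C.σ (((n : ℤ) + 1) * C.k) + p * j := by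
    intro n
    obtain ⟨j, hj⟩ := exists_liftZ_iterate_eq p q r M (M * q + q - p + δ) n
    have h1 := C.lift_iterate C.k n
    rw [hk2, show M * q + q + δ = M * q + q - p + δ + p * 1 by ring, liftZ_iterate_add_mul,
      hj, show C.k + n * C.k = ((n : ℤ) + 1) * C.k by ring] at h1
    exact ⟨-(j + 1), by rw [endpoint]; linear_combination h1⟩
  have hF : ∀ m : ℕ, ∃ j, (stepZ p q r M)^[m] (r - δ') =
      C.σ (((n₀ : ℤ) + m) * C.k) + p * j := by
    intro m
    obtain ⟨j, hj⟩ := exists_liftZ_iterate_eq p q r M (r - δ') m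
    have h1 := C.lift_iterate (i₁ + 1) m
    obtain ⟨t, ht⟩ := O.hit
    rw [hs2, hj] at h1
    have h2 : i₁ + 1 + m * C.k = (n₀ + m) * C.k + C.s * -t := by linear_combination -ht
    rw [h2, C.map_add_mul] at h1
    exact ⟨-t - j, by linear_combination h1⟩
  -- A gap is described by its right end, which is a core point, and its number l of integers.
  have hIco : ∀ (N : ℤ) (j z l : ℤ), z = C.σ (N * C.k) + p * j →
      C.σ (-1 + N * C.k + 1) - C.σ (-1 + N * C.k) = l + 1 →
      C.gap (-1 + N * C.k) = periodize p (Set.Ico (z + -l) z) := by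
    rintro N j z l rfl hl
    rw [show C.σ (N * C.k) + p * j + -l = (C.σ (N * C.k) - l) + p * j by ring,
      periodize_Ico_add_mul, Coding.gap]
    rw [neg_add_cancel_comm] at hl ⊢
    congr 1
    ext x
    simp only [Set.mem_Ioo, Set.mem_Ico]
    omega
  have hbig0 : periodize p (Set.Ico (M * q + δ') (M * q + (q - p + δ))) =
      periodize p (Set.Ioo (C.σ (-1 + C.k)) (C.σ (-1 + C.k + 1))) := by
    rw [← periodize_Ico_add_mul _ _ 1, neg_add_cancel_comm, hk1, hk2]
    congr 1
    ext x
    simp only [Set.mem_Ioo, Set.mem_Ico]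
    omega
  have hbig : ∀ n : ℕ, n < n₀ → bigGapZ p q r M δ δ' n = C.gap (-1 + ((n : ℤ) + 1) * C.k) := by
    intro n hn
    rw [bigGapZ, periodize_image_congr hbig0, periodize_image_stepZ,
      O.split.image_Ioo h (fun m hm => O.not_dvd_before (by omega)), Coding.gap,
      show -1 + C.k + n * C.k = -1 + ((n : ℤ) + 1) * C.k by ring]
  have hlenB : ∀ n : ℕ, n < n₀ → C.σ (-1 + ((n : ℤ) + 1) * C.k + 1) -
      C.σ (-1 + ((n : ℤ) + 1) * C.k) = (q - p + δ - δ') + 1 := by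
    intro n hn
    rw [O.length_before h (by omega), hk1, hk2]
    ring
  have hgenk : n₀ < L → C.σ (i₁ + C.k) = M * q + r + p - δ - 1 ∧
      C.σ (i₁ + C.k + 1) = M * q + r + p - δ' := by
    intro hlt
    obtain ⟨g1, g2, -⟩ := hgen hlt
    rw [O.split.map_left h (by omega) le_rfl, add_right_comm i₁ C.k 1,
      O.split.map_right h (by omega) (by omega), hs1, hs2]
    constructor <;> ring
  -- With the hole removed, its two sides are moved by Mq + q and Mq + p and meet at Mq + r + p,
  -- forming one gap of length δ - δ'.
  have hsmall0 : n₀ < L → (liftZ p q r M) ''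
      (Set.Ico (r + p - q - δ) (r - δ') \ Set.Ico (r + p - q) r) =
      Set.Ioo (C.σ (i₁ + C.k)) (C.σ (i₁ + C.k + 1)) := by
    intro hlt
    obtain ⟨e1, e2⟩ := hgenk hlt
    rw [e1, e2]
    ext y
    simp only [Set.mem_image, Set.mem_sdiff, Set.mem_Ico, Set.mem_Ioo]
    constructor
    · rintro ⟨x, hx, rfl⟩
      rcases lt_or_ge x r with hxr | hxr
      · rw [liftZ_left h (j := 0) (by omega) (by omega)]; omega
      · rw [liftZ_right h (j := 0) (by omega) (by omega)]; omega
    · intro hy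
      rcases lt_or_ge y (M * q + r + p) with hyr | hyr
      · refine ⟨y - M * q - q, by omega, ?_⟩
        rw [liftZ_left h (j := 0) (by omega) (by omega)]; ring
      · refine ⟨y - M * q - p, by omega, ?_⟩
        rw [liftZ_right h (j := 0) (by omega) (by omega)]; ring
  have hsmall : ∀ m : ℕ, 1 ≤ m → m ≤ L - n₀ →
      smallGapZ p q r M δ δ' m = C.gap (-1 + ((n₀ : ℤ) + m) * C.k) := by
    intro m hm hm'
    obtain ⟨m, rfl⟩ : ∃ m', m = m' + 1 := ⟨m - 1, by omega⟩
    have h1 : periodize p (stepZ p q r M ''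
        (Set.Ico (r + p - q - δ) (r - δ') \ Set.Ico (r + p - q) r)) =
        periodize p (Set.Ioo (C.σ (i₁ + C.k)) (C.σ (i₁ + C.k + 1))) := by
      rw [← hsmall0 (by omega)]
      exact periodize_image_stepZ 1 _
    rw [smallGapZ, Function.iterate_succ, Set.image_comp, periodize_image_congr h1,
      periodize_image_stepZ, O.split.image_Ioo h, Coding.gap_congr (O.hit_congr (m + 1 : ℕ)),
      Coding.gap]
    · rw [show i₁ + C.k + m * C.k = i₁ + ((m + 1 : ℕ) : ℤ) * C.k by push_cast; ring]
    · intro i hi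
      have := O.not_dvd_after (m := i + 1) (by omega) (by omega)
      push_cast at this
      rwa [show i₁ + C.k + i * C.k = i₁ + (i + 1) * C.k by ring]
  have hlenS : ∀ m : ℕ, 1 ≤ m → m ≤ L - n₀ → C.σ (-1 + ((n₀ : ℤ) + m) * C.k + 1) -
      C.σ (-1 + ((n₀ : ℤ) + m) * C.k) = (δ - δ') + 1 := by
    intro m hm hm'
    obtain ⟨m, rfl⟩ : ∃ m', m = m' + 1 := ⟨m - 1, by omega⟩
    obtain ⟨e1, e2⟩ := hgenk (by omega)
    have := O.length_after h hm'
    push_cast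
    rw [this, e1, e2]
    ring
  have hlast : bigGapZ p q r M δ δ' (n₀ - 1) =
      periodize p (Set.Ico (r + p - q - δ) (r - δ')) := by
    rw [hbig _ (by omega), Nat.cast_sub hn1, Nat.cast_one, sub_add_cancel]
    have := O.hit_congr 0
    rw [zero_mul, add_zero, add_zero] at this
    rw [Coding.gap_congr this, Coding.gap, hs1, hs2]
    congr 1
    ext x
    simp only [Set.mem_Ioo, Set.mem_Ico]
    omega
  have hndvd : ∀ {n n' : ℤ}, 1 ≤ n → n ≤ L → 1 ≤ n' → n' ≤ L → n ≠ n' → ¬ (L : ℤ) ∣ n - n' := by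
    intro n n' h1 h2 h3 h4 hne hd
    have := Int.eq_zero_of_abs_lt_dvd hd (by rw [abs_lt]; omega)
    omega
  have hsep : ∀ {n n' : ℤ}, 1 ≤ n → n ≤ L → 1 ≤ n' → n' ≤ L → n ≠ n' →
      ∀ x ∈ C.gap (-1 + n * C.k), ∀ y ∈ C.gap (-1 + n' * C.k), 2 ≤ |x - y| := by
    intro n n' h1 h2 h3 h4 hne x hx y hy
    exact Coding.two_le_of_mem_gap (fun hd => hndvd h1 h2 h3 h4 hne (O.dvd_sub_iff.mp hd)) hx hy
  -- The hole is fixed pointwise and already lies in the last big gap, so including it does not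
  -- alter the union.
  have hhole : ∀ m : ℕ, periodize p ((stepZ p q r M)^[m] '' Set.Ico (r + p - q - δ) (r - δ')) =
      smallGapZ p q r M δ δ' m ∪ periodize p (Set.Ico (r + p - q) r) := by
    intro m
    have h1 : Set.Ico (r + p - q - δ) (r - δ') =
        (Set.Ico (r + p - q - δ) (r - δ') \ Set.Ico (r + p - q) r) ∪ Set.Ico (r + p - q) r := by
      rw [Set.sdiff_union_self, Set.union_eq_left.mpr]
      exact Set.Ico_subset_Ico (by omega) (by omega)
    have h2 : (stepZ p q r M)^[m] '' Set.Ico (r + p - q) r = Set.Ico (r + p - q) r := by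
      have : Set.EqOn ((stepZ p q r M)^[m]) id (Set.Ico (r + p - q) r) := fun x hx =>
        stepZ_iterate_of_inHole m (inHole_of_mem h (j := 0) (by simpa using hx.1)
          (by simpa using hx.2))
      rw [this.image_eq, Set.image_id]
    conv_lhs => rw [h1]
    rw [Set.image_union, h2, periodize_union, smallGapZ]
  have hholesub : periodize p (Set.Ico (r + p - q) r) ⊆ bigGapZ p q r M δ δ' (n₀ - 1) := by
    rw [hlast]
    exact periodize_mono (Set.Ico_subset_Ico (by omega) (by omega))
  have hcompl : (core p q r M)ᶜ = (⋃ n ∈ Set.Icc 0 (n₀ - 1), bigGapZ p q r M δ δ' n) ∪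
      ⋃ m ∈ Set.Icc 1 (L - n₀),
        periodize p ((stepZ p q r M)^[m] '' Set.Ico (r + p - q - δ) (r - δ')) := by
    ext x
    rw [Set.mem_compl_iff, O.compl_core h]
    simp only [Set.mem_union, Set.mem_iUnion, Set.mem_Icc, exists_prop, hhole]
    constructor
    · rintro ⟨n, h1, h2, hx⟩
      rcases le_or_gt n n₀ with hn | hn
      · refine .inl ⟨n - 1, ⟨by omega, by omega⟩, ?_⟩
        rw [hbig _ (by omega), Nat.cast_sub h1, Nat.cast_one, sub_add_cancel]
        exact hx
      · refine .inr ⟨n - n₀, ⟨by omega, by omega⟩, .inl ?_⟩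
        rw [hsmall _ (by omega) (by omega), Nat.cast_sub hn.le, add_sub_cancel]
        exact hx
    · have hB : ∀ n : ℕ, n < n₀ → x ∈ bigGapZ p q r M δ δ' n →
          ∃ n : ℕ, 1 ≤ n ∧ n ≤ L ∧ x ∈ C.gap (-1 + n * C.k) := by
        intro n hn hx
        rw [hbig n hn] at hx
        exact ⟨n + 1, by omega, by omega, by push_cast; exact hx⟩
      rintro (⟨n, hn, hx⟩ | ⟨m, hm, hx | hx⟩)
      · exact hB n (by omega) hx
      · rw [hsmall m hm.1 hm.2] at hx
        exact ⟨n₀ + m, by omega, by omega, by push_cast; exact hx⟩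
      · exact hB _ (by omega) (hholesub hx)
  have hblock : ∀ n : ℕ, periodize p (Set.Ico (endpoint p q r M δ n) (endpoint p q r M δ n + d)) =
      periodize p (Set.Ico (C.σ ((n + 1) * C.k)) (C.σ ((n + 1) * C.k) + d)) := by
    intro n
    obtain ⟨j, hj⟩ := hE n
    rw [hj, add_right_comm, periodize_Ico_add_mul]
  -- `bigGapZ` starts one step after the origin gap, so N₁ = n₀ - 1; the remaining L - n₀ gaps of
  -- the orbit are small, and d is the length of a run of the core.
  refine ⟨δ, δ', d, n₀ - 1, L - n₀, ?_⟩
  constructor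
  · exact hδ0
  · exact hδ1
  · exact hδ2
  · exact hδ3
  · rcases hδδ with rfl | rfl <;> simp
  · intro n hn
    obtain ⟨j, hj⟩ := hE n
    rw [hbig n (by omega), hIco _ j _ _ hj (hlenB n (by omega)),
      show -(q - p + δ - δ') = p - q + δ' - δ by ring]
  · exact hlast
  · obtain ⟨j, hj⟩ := hE (n₀ - 1)
    obtain ⟨j', hj'⟩ := hF 0
    rw [Nat.cast_sub hn1, Nat.cast_one, sub_add_cancel] at hj
    rw [Nat.cast_zero, add_zero, Function.iterate_zero_apply] at hj'
    exact ⟨j - j', by rw [hj, hj']; ring⟩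
  · intro m hm hm'
    obtain ⟨j, hj⟩ := hF m
    rw [hsmall m hm hm', hIco _ j _ _ hj (hlenS m hm hm'), neg_sub]
  · rcases eq_or_lt_of_le hnL with he | hlt
    -- For N₂ = 0 the part of the gap outside the hole is [0, r + p - q) or [r, p), which is [δ', δ)
    -- modulo p.
    · rw [← he, Nat.sub_self, smallGapZ, Function.iterate_zero, Set.image_id]
      rcases hspec he with ⟨rfl, rfl⟩ | ⟨rfl, rfl⟩
      · congr 1
        ext x
        simp only [Set.mem_sdiff, Set.mem_Ico]
        omega
      · rw [← periodize_Ico_add_mul _ _ 1]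
        congr 1
        ext x
        simp only [Set.mem_sdiff, Set.mem_Ico]
        omega
    · obtain ⟨-, -, g3, g4⟩ := hgen hlt
      -- After L steps the orbit is back at the gap around the origin.
      have hL : C.s ∣ (-1 + ((n₀ : ℤ) + (L - n₀ : ℕ)) * C.k) - -1 := by
        rw [Nat.cast_sub hnL, add_sub_cancel, add_sub_cancel_left, O.dvd_iff]
      rw [hsmall _ (by omega) le_rfl, Coding.gap_congr hL, Coding.gap, neg_add_cancel, g3, g4]
      congr 1
      ext x
      simp only [Set.mem_Ioo, Set.mem_Ico]
      omega
  · rintro h0 h0'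
    have hlt : n₀ < L := by
      refine lt_of_le_of_ne hnL fun he => ?_
      have := hspec he
      omega
    obtain ⟨-, -, g3, g4⟩ := hgen hlt
    obtain ⟨j, hj⟩ := hF (L - n₀)
    obtain ⟨t, ht⟩ := (O.dvd_iff L).mpr dvd_rfl
    have := C.map_add_mul 0 t
    rw [zero_add, ← ht, g4] at this
    rw [h0', sub_zero, Nat.cast_sub hnL, add_sub_cancel, this] at hj
    exact ⟨t + j, by rw [hj, h0]; ring⟩
  · intro n hn n' hn' hne
    rw [hbig n (by omega), hbig n' (by omega)]
    exact hsep (by omega) (by omega) (by omega) (by omega) (by omega)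
  · intro m hm m' hm' hne
    have := hm.2; have := hm'.2; have := hm.1; have := hm'.1
    rw [hsmall m hm.1 hm.2, hsmall m' hm'.1 hm'.2]
    exact hsep (by omega) (by omega) (by omega) (by omega) (by omega)
  · intro n hn m hm
    have := hm.2; have := hm.1
    rw [hbig n (by omega), hsmall m hm.1 hm.2]
    exact hsep (by omega) (by omega) (by omega) (by omega) (by omega)
  · intro m hm m' hm' hne j he
    have := hm.2; have := hm'.2; have := hm.1; have := hm'.1
    obtain ⟨i, hi⟩ := hF m
    obtain ⟨i', hi'⟩ := hF m'
    have : C.σ ((n₀ + m) * C.k) = C.σ ((n₀ + m') * C.k + C.s * (i' + j - i)) := by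
      rw [C.map_add_mul]; linear_combination he - hi + hi'
    have := C.mono.injective this
    refine hndvd (n := n₀ + m) (n' := n₀ + m') (by omega) (by omega) (by omega) (by omega)
      (by omega) ((O.dvd_sub_iff (e := 0)).mp ⟨i' + j - i, ?_⟩)
    linear_combination this
  · intro n hn m hm x hx j
    have := hm.2; have := hm.1
    rw [hbig n (by omega)] at hx
    obtain ⟨i, hi⟩ := hF m
    have := Coding.ne_of_mem_gap (i' := -1 + (n₀ + m) * C.k) (j := i + j)
      (fun hd => hndvd (n := n + 1) (n' := n₀ + m) (by omega) (by omega) (by omega) (by omega)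
      (by omega) (O.dvd_sub_iff.mp hd)) hx
    rw [neg_add_cancel_comm, mul_add] at this
    omega
  · exact hcompl
  · rw [hcompl]
    ext x
    simp only [Set.mem_union, Set.mem_iUnion, Set.mem_Icc, exists_prop]
    have hadd : ∀ m : ℕ, bigGapZ p q r M δ δ' (n₀ - 1 + m) =
        periodize p ((stepZ p q r M)^[m] '' Set.Ico (r + p - q - δ) (r - δ')) := by
      intro m
      rw [bigGapZ, add_comm, Function.iterate_add, Set.image_comp]
      exact periodize_image_congr hlast m
    simp only [← hadd]
    constructor
    · rintro (⟨n, hn, hx⟩ | ⟨m, hm, hx⟩)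
      · exact ⟨n, by omega, hx⟩
      · exact ⟨n₀ - 1 + m, by omega, hx⟩
    · rintro ⟨n, hn, hx⟩
      rcases le_or_gt n (n₀ - 1) with hle | hlt
      · exact .inl ⟨n, by omega, hx⟩
      · refine .inr ⟨n - (n₀ - 1), by omega, ?_⟩
        rwa [Nat.add_sub_cancel' hlt.le]
  · exact O.d_pos
  · ext x
    rw [O.mem_core_iff h]
    simp only [Set.mem_iUnion, Set.mem_Icc, exists_prop, hblock]
    constructor
    · rintro ⟨n, h1, h2, hx⟩
      refine ⟨n - 1, by omega, ?_⟩
      rwa [Nat.cast_sub h1, Nat.cast_one, sub_add_cancel]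
    · rintro ⟨n, hn, hx⟩
      exact ⟨n + 1, by omega, by omega, by push_cast; exact hx⟩
  · intro n hn n' hn' hne
    rw [hblock, hblock]
    exact O.disjoint_blocks h (hndvd (by omega) (by omega) (by omega) (by omega) (by omega))
  · have hsum := O.sum_length h
    obtain ⟨N₂, rfl⟩ : ∃ N, L = n₀ + N := ⟨L - n₀, by omega⟩
    have hA : ∀ n ∈ Finset.range n₀, C.σ (-1 + ((n : ℤ) + 1) * C.k + 1) -
        C.σ (-1 + ((n : ℤ) + 1) * C.k) - 1 = q - p + δ - δ' := fun n hn => by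
      rw [hlenB n (Finset.mem_range.mp hn), add_sub_cancel_right]
    have hB : ∀ n ∈ Finset.range N₂, C.σ (-1 + (((n₀ + n : ℕ) : ℤ) + 1) * C.k + 1) -
        C.σ (-1 + (((n₀ + n : ℕ) : ℤ) + 1) * C.k) - 1 = δ - δ' := fun n hn => by
      have := hlenS (n + 1) (by omega) (by have := Finset.mem_range.mp hn; omega)
      rw [show ((n₀ + n : ℕ) : ℤ) + 1 = n₀ + (n + 1 : ℕ) by push_cast; ring, this,
        add_sub_cancel_right]
    rw [Finset.sum_range_add, Finset.sum_congr rfl hA, Finset.sum_congr rfl hB] at hsum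
    simp only [Finset.sum_const, Finset.card_range, nsmul_eq_mul] at hsum
    rw [O.s_eq] at hsum
    rw [Nat.add_sub_cancel_left, Nat.cast_sub hn1]
    push_cast at hsum ⊢
    linear_combination -hsum

end


/-! ### Binary solutions as orbits avoiding the hole -/

section

variable {p q r M : ℤ}

theorem stepZ_cases (h : Admissible p q r) {x j : ℤ} (hx : ¬ InHole p q r x) (h₁ : p * j ≤ x)
    (h₂ : x < p * j + p) :
    (x < p * j + (r + p - q) ∧ stepZ p q r M x = x + M * q + q) ∨
      (p * j + r ≤ x ∧ stepZ p q r M x = x + M * q) := by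
  have := h.lt; have := h.sub_lt; have := h.lt'
  rw [InHole, emod_eq_of_mem h₁ h₂] at hx
  rw [stepZ, emod_eq_of_mem h₁ h₂]
  rcases lt_or_ge (x - p * j) (r + p - q) with h' | h'
  · rw [if_pos h']; omega
  · rw [if_neg (by omega), if_neg (by omega)]; omega

theorem stepZ_injOn (h : Admissible p q r) {x y : ℤ} (hx : x ∈ core p q r M)
    (hy : y ∈ core p q r M) (hxy : stepZ p q r M x = stepZ p q r M y) : x = y := by
  obtain ⟨i, hi⟩ := exists_liftZ_eq p q r M x
  obtain ⟨j, hj⟩ := exists_liftZ_eq p q r M y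
  have h1 : liftZ p q r M x = liftZ p q r M (y + p * (i - j)) := by
    rw [liftZ_add_mul, hi, hj, hxy]; ring
  have h2 : x = y + p * (i - j) := liftZ_injOn h (hx 0) (by simpa [inHole_add_mul] using hy 0) h1
  rw [h2, stepZ_add_mul] at hxy
  omega

theorem exists_stepZ_eq (h : Admissible p q r) {y : ℤ} (hy : y ∈ core p q r M) :
    ∃ x ∈ core p q r M, stepZ p q r M x = y := by
  obtain ⟨x, hx, rfl⟩ := exists_liftZ_eq_of_mem_core h hy
  obtain ⟨i, hi⟩ := exists_liftZ_eq p q r M x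
  exact ⟨x + p * i, add_mul_mem_core.mpr hx, by rw [stepZ_add_mul, hi]⟩

theorem exists_biinfinite_orbit (h : Admissible p q r) {x : ℤ} (hx : x ∈ core p q r M) :
    ∃ v : ℤ → ℤ, v 0 = x ∧ (∀ i, v i ∈ core p q r M) ∧ ∀ i, v (i + 1) = stepZ p q r M (v i) := by
  let f : core p q r M → core p q r M := fun y => ⟨stepZ p q r M y, stepZ_mem_core y.2⟩
  have hf : Function.Bijective f := by
    refine ⟨fun y z hyz => Subtype.ext (stepZ_injOn h y.2 z.2 (congrArg Subtype.val hyz)), ?_⟩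
    intro y
    obtain ⟨z, hz, hzy⟩ := exists_stepZ_eq h y.2
    exact ⟨⟨z, hz⟩, Subtype.ext hzy⟩
  let e : Equiv.Perm (core p q r M) := Equiv.ofBijective f hf
  refine ⟨fun i => ((e ^ i) ⟨x, hx⟩ : core p q r M), by simp, fun i => Subtype.prop _, fun i => ?_⟩
  simp only
  rw [add_comm, zpow_add, zpow_one, Equiv.Perm.mul_apply]
  rfl

/-- The points x + lq with l ∈ Λ meet each window [pm, pm + Mq + r) exactly once, and `stepZ` gives
the next point. Backward invertibility on the core supplies the points to the left of x. -/
theorem mem_core_iff_exists_tiling (h : Admissible p q r) (hM : 1 ≤ M) {x : ℤ} :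
    x ∈ core p q r M ↔ ∃ Λ : Set ℤ, 0 ∈ Λ ∧ ∀ m, ∃! l, l ∈ Λ ∧ 0 ≤ x - m * p + l * q ∧
      x - m * p + l * q < M * q + r := by
  have hp := h.pos
  have hpq := h.lt; have hr1 := h.sub_lt; have hr2 := h.lt'
  have hMq : q ≤ M * q := le_mul_of_one_le_left (by omega) hM
  constructor
  · intro hx
    obtain ⟨v, hv0, hv, hstep⟩ := exists_biinfinite_orbit h hx
    -- A point of [pj, pj + p) is sent between the right ends of the windows j and j + 1.
    have hbd : ∀ i j, p * j ≤ v i → v i < p * j + p →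
        p * j + (M * q + r) ≤ v (i + 1) ∧ v (i + 1) < p * j + p + (M * q + r) := by
      intro i j h₁ h₂
      rw [hstep]
      rcases stepZ_cases (M := M) h (not_inHole_of_mem_core (hv i)) h₁ h₂ with
        ⟨h₃, h₄⟩ | ⟨h₃, h₄⟩ <;> omega
    have hmono : StrictMono v := strictMono_int_of_lt_succ fun i => by
      obtain ⟨j, h₁, h₂⟩ := exists_mul_le hp (v i)
      have := hbd i j h₁ h₂
      omega
    have hd : ∀ i, q ∣ v (i + 1) - v i := by
      intro i
      obtain ⟨j, h₁, h₂⟩ := exists_mul_le hp (v i)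
      rw [hstep]
      rcases stepZ_cases (M := M) h (not_inHole_of_mem_core (hv i)) h₁ h₂ with ⟨-, h₄⟩ | ⟨-, h₄⟩ <;>
        rw [h₄]
      · exact ⟨M + 1, by ring⟩
      · exact ⟨M, by ring⟩
    have hd' : ∀ i, q ∣ v i - x := by
      intro i
      induction i using Int.induction_on with
      | zero => simp [hv0]
      | succ i ih =>
        have := dvd_add (hd i) ih
        rwa [sub_add_sub_cancel] at this
      | pred i ih =>
        have := dvd_sub ih (hd (-i - 1))
        rwa [sub_add_cancel, sub_sub_sub_cancel_left] at this
    refine ⟨{l | ∃ i, x + l * q = v i}, ⟨0, by simp [hv0]⟩, fun m => ?_⟩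
    -- The only orbit point in window m is the first one at or beyond pm.
    obtain ⟨i, h₁, h₂⟩ := exists_index_of_strictMono hmono (p * m)
    obtain ⟨l, hl⟩ := hd' (i + 1)
    have hl' : x + l * q = v (i + 1) := by linear_combination -hl
    refine ⟨l, ⟨⟨i + 1, hl'⟩, by rw [mul_comm m p]; omega, ?_⟩, ?_⟩
    · obtain ⟨j, h₃, h₄⟩ := exists_mul_le hp (v i)
      have hjm : j < m := lt_of_mul_lt_mul_left (h₃.trans_lt h₁) hp.le
      have : p * (j + 1) ≤ p * m := mul_le_mul_of_nonneg_left hjm hp.le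
      rw [mul_add, mul_one] at this
      have := hbd i j h₃ h₄
      rw [mul_comm m p]
      omega
    · rintro l' ⟨⟨i', hi'⟩, h₃, h₄⟩
      rw [mul_comm m p] at h₃ h₄
      have hle : i + 1 ≤ i' := by
        by_contra hc
        have := hmono.monotone (show i' ≤ i by omega)
        omega
      have hge : i' ≤ i + 1 := by
        by_contra hc
        have := hmono.monotone (show i + 1 + 1 ≤ i' by omega)
        obtain ⟨j, h₅, h₆⟩ := exists_mul_le hp (v (i + 1))
        have hjm : m < j + 1 := lt_of_mul_lt_mul_left (by rw [mul_add]; omega) hp.le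
        have : p * m ≤ p * j := mul_le_mul_of_nonneg_left (by omega) hp.le
        have := hbd (i + 1) j h₅ h₆
        omega
      obtain rfl : i' = i + 1 := le_antisymm hge hle
      rw [← hl', add_right_inj] at hi'
      exact mul_right_cancel₀ (by omega) hi'
  · rintro ⟨Λ, h0, hΛ⟩
    have key : ∀ l ∈ Λ, ¬ InHole p q r (x + l * q) ∧
        ∃ l' ∈ Λ, x + l' * q = stepZ p q r M (x + l * q) := by
      intro l hl
      obtain ⟨j, h₁, h₂⟩ := exists_mul_le hp (x + l * q)
      obtain ⟨l', ⟨hl', h₃, h₄⟩, -⟩ := hΛ (j + 1)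
      rw [add_mul, one_mul, mul_comm j p] at h₃ h₄
      -- Window j already contains x + lq, so the point of window j + 1 lies beyond window j.
      have h₅ : p * j + (M * q + r) ≤ x + l' * q := by
        by_contra hc
        have := (hΛ j).unique ⟨hl', by rw [mul_comm j p]; omega, by rw [mul_comm j p]; omega⟩
          ⟨hl, by rw [mul_comm j p]; omega, by rw [mul_comm j p]; omega⟩
        subst this
        omega
      -- The increment minus Mq is a multiple of q strictly between r - p > -q and r + p < 2q, so it
      -- is 0 or q. The first value forces x + lq to the right of the hole, the second to its left.
      have h₆ : x + l' * q = x + l * q + M * q + (l' - l - M) * q := by ring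
      have h₇ : 0 ≤ l' - l - M := by
        by_contra hc
        have : (l' - l - M) * q ≤ -1 * q := mul_le_mul_of_nonneg_right (by omega) (by omega)
        omega
      have h₈ : l' - l - M ≤ 1 := by
        by_contra hc
        have : 2 * q ≤ (l' - l - M) * q := mul_le_mul_of_nonneg_right (by omega) (by omega)
        omega
      obtain h₉ | h₉ : l' - l - M = 0 ∨ l' - l - M = 1 := by omega
      · rw [h₉] at h₆
        have hh := not_inHole_right h (j := j) (x := x + l * q) (by omega) (by omega)
        refine ⟨hh, l', hl', ?_⟩
        rcases stepZ_cases (M := M) h hh h₁ h₂ with h' | h' <;> omega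
      · rw [h₉] at h₆
        have hh := not_inHole_left h (j := j) (x := x + l * q) (by omega) (by omega)
        refine ⟨hh, l', hl', ?_⟩
        rcases stepZ_cases (M := M) h hh h₁ h₂ with h' | h' <;> omega
    rw [mem_core_iff_stepZ]
    have hiter : ∀ n : ℕ, ∃ l ∈ Λ, x + l * q = (stepZ p q r M)^[n] x := by
      intro n
      induction n with
      | zero => exact ⟨0, h0, by simp⟩
      | succ n ih =>
        obtain ⟨l, hl, hln⟩ := ih
        obtain ⟨-, l', hl', hl''⟩ := key l hl
        exact ⟨l', hl', by rw [hl'', hln, Function.iterate_succ_apply']⟩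
    intro n
    obtain ⟨l, hl, hln⟩ := hiter n
    rw [← hln]
    exact (key l hl).1

end

theorem hasSum_one_iff {ι : Type*} {y : ι → ℝ} (hy : ∀ i, y i = 0 ∨ y i = 1) :
    HasSum y 1 ↔ ∃! i, y i = 1 := by
  classical
  constructor
  · intro hs
    have hex : ∃ i, y i = 1 := by
      by_contra hc
      push Not at hc
      have : y = fun _ => 0 := funext fun i => (hy i).resolve_right (hc i)
      rw [this] at hs
      exact zero_ne_one (hasSum_zero.unique hs)
    obtain ⟨i, hi⟩ := hex
    refine ⟨i, hi, fun j hj => ?_⟩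
    by_contra hne
    have := sum_le_hasSum {j, i} (fun k _ => by rcases hy k with h | h <;> simp [h]) hs
    rw [Finset.sum_pair hne] at this
    have hj : y j = 1 := hj
    rw [hi, hj] at this
    norm_num at this
  · rintro ⟨i, hi, hu⟩
    have hi : y i = 1 := hi
    rw [← hi]
    exact hasSum_single i fun j hj => (hy j).resolve_right fun h => hj (hu j h)


/-! ### Transfer between the real line and the integers -/

/-- The index of the cell `[n u, (n + 1) u)` that contains `t`. -/
noncomputable def cell (u t : ℝ) : ℤ := ⌊t / u⌋

section

variable {u t : ℝ} {p q r M : ℤ}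

theorem le_cell (hu : 0 < u) {n : ℤ} : n ≤ cell u t ↔ n * u ≤ t := by
  rw [cell, Int.le_floor, le_div_iff₀ hu]

theorem cell_lt (hu : 0 < u) {n : ℤ} : cell u t < n ↔ t < n * u := by
  rw [cell, Int.floor_lt, div_lt_iff₀ hu]

theorem cell_mul_le (hu : 0 < u) (t : ℝ) : cell u t * u ≤ t := (le_cell hu).mp le_rfl

theorem lt_cell_mul (hu : 0 < u) (t : ℝ) : t < (cell u t + 1) * u := by
  have := (cell_lt hu (t := t) (n := cell u t + 1)).mp (by omega)
  exact_mod_cast this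

theorem cell_add_mul (hu : 0 < u) (n : ℤ) : cell u (t + n * u) = cell u t + n := by
  rw [cell, add_div, mul_div_cancel_right₀ _ hu.ne', Int.floor_add_intCast, cell]

theorem cell_mul (hu : 0 < u) (n : ℤ) : cell u (n * u) = n := by
  rw [cell, mul_div_cancel_right₀ _ hu.ne', Int.floor_intCast]

theorem Ico_eq_preimage (hu : 0 < u) (m n : ℤ) :
    Set.Ico ((m : ℝ) * u) (n * u) = cell u ⁻¹' Set.Ico m n := by
  ext t
  simp only [Set.mem_Ico, Set.mem_preimage, le_cell hu, cell_lt hu]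

theorem mem_add_lattice {E : Set ℝ} {x : ℝ} :
    t ∈ E + lattice x ↔ ∃ k : ℤ, t + k * x ∈ E := by
  rw [Set.mem_add]
  constructor
  · rintro ⟨y, hy, -, ⟨k, rfl⟩, rfl⟩
    exact ⟨-k, by push_cast; simpa [add_assoc] using hy⟩
  · rintro ⟨k, hk⟩
    exact ⟨_, hk, _, ⟨-k, rfl⟩, by push_cast; ring⟩

theorem preimage_add_lattice (hu : 0 < u) (E : Set ℤ) :
    cell u ⁻¹' E + lattice ((p : ℝ) * u) = cell u ⁻¹' periodize p E := by
  ext t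
  rw [mem_add_lattice]
  refine exists_congr fun k => ?_
  rw [Set.mem_preimage, show t + (k : ℝ) * (p * u) = t + ((p * k : ℤ) : ℝ) * u by push_cast; ring,
    cell_add_mul hu]

theorem singleton_add_Ico (hu : 0 < u) (m x y : ℤ) :
    {(m : ℝ) * u} + Set.Ico ((x : ℝ) * u) (y * u) = cell u ⁻¹' Set.Ico (m + x) (m + y) := by
  rw [← Ico_eq_preimage hu, Set.singleton_add, Set.image_const_add_Ico]
  push_cast
  rw [add_mul, add_mul]

end

section

variable {a b c u t : ℝ} {p q r M : ℤ}

/-- The real parameters `a`, `b`, `c` are `p`, `q`, `M q + r` in units of `u`. -/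
structure Scaled (a b c u : ℝ) (p q r M : ℤ) : Prop where
  pos : 0 < u
  adm : Admissible p q r
  le : 1 ≤ M
  a_eq : a = p * u
  b_eq : b = q * u
  c_eq : c = ((M * q + r : ℤ) : ℝ) * u
  c₀_eq : c₀ b c = r * u
  floor_eq : ⌊c / b⌋ = M

namespace Scaled

variable (H : Scaled a b c u p q r M)
include H

/-- The breakpoints of R and its displacements are integer multiples of u, so R moves each cell
rigidly. -/
theorem R_eq (t : ℝ) : R a b c t = t + ((stepZ p q r M (cell u t) - cell u t : ℤ) : ℝ) * u := by
  have hu := H.pos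
  have hper : ∀ m n : ℤ, 0 ≤ m → n ≤ p → (t ∈ Set.Ico ((m : ℝ) * u) (n * u) + lattice a ↔
      m ≤ cell u t % p ∧ cell u t % p < n) := by
    intro m n hm hn
    rw [H.a_eq, Ico_eq_preimage hu, preimage_add_lattice hu, Set.mem_preimage]
    constructor
    · rintro ⟨j, h₁, h₂⟩
      have := emod_eq_of_mem (p := p) (x := cell u t) (j := -j) (by rw [mul_neg]; omega)
        (by rw [mul_neg]; omega)
      rw [this, mul_neg]
      omega
    · rintro ⟨h₁, h₂⟩
      exact ⟨-(cell u t / p), by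
        rw [Int.emod_def] at h₁ h₂; rw [mul_neg, ← sub_eq_add_neg]; exact ⟨h₁, h₂⟩⟩
  have h1 := H.adm.lt; have h2 := H.adm.sub_lt; have h3 := H.adm.lt'
  have e1 := hper 0 (r + p - q) le_rfl (by omega)
  have e2 := hper (r + p - q) r (by omega) (by omega)
  have h0 := Int.emod_nonneg (cell u t) H.adm.pos.ne'
  have f1 : c₀ b c + a - b = ((r + p - q : ℤ) : ℝ) * u := by
    rw [H.c₀_eq, H.a_eq, H.b_eq]; push_cast; ring
  rw [R, f1, H.c₀_eq, H.floor_eq, stepZ]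
  rw [Int.cast_zero, zero_mul] at e1
  simp only [e1, e2]
  rw [H.b_eq]
  by_cases g1 : cell u t % p < r + p - q
  · rw [if_pos ⟨h0, g1⟩, if_pos g1]
    push_cast
    ring
  · rw [if_neg (fun hc => g1 hc.2), if_neg g1]
    by_cases g2 : cell u t % p < r
    · rw [if_pos ⟨by omega, g2⟩, if_pos g2]
      simp
    · rw [if_neg (fun hc => g2 hc.2), if_neg g2]
      push_cast
      ring

theorem cell_R (t : ℝ) : cell u (R a b c t) = stepZ p q r M (cell u t) := by
  rw [H.R_eq, cell_add_mul H.pos]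
  ring

theorem R_iterate_eq (n : ℕ) (t : ℝ) : (R a b c)^[n] t =
    t + (((stepZ p q r M)^[n] (cell u t) - cell u t : ℤ) : ℝ) * u := by
  induction n generalizing t with
  | zero => simp
  | succ n ih =>
    rw [Function.iterate_succ_apply, ih, H.cell_R, Function.iterate_succ_apply, H.R_eq]
    push_cast
    ring

theorem R_iterate_mul (n : ℕ) (m : ℤ) :
    (R a b c)^[n] (m * u) = ((stepZ p q r M)^[n] m : ℤ) * u := by
  rw [H.R_iterate_eq, cell_mul H.pos]
  push_cast
  ring

theorem R_iterate_image (n : ℕ) (E : Set ℤ) :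
    (R a b c)^[n] '' (cell u ⁻¹' E) = cell u ⁻¹' ((stepZ p q r M)^[n] '' E) := by
  ext t
  constructor
  · rintro ⟨s, hs, rfl⟩
    refine ⟨cell u s, hs, ?_⟩
    rw [H.R_iterate_eq, cell_add_mul H.pos]
    ring
  · rintro ⟨x, hx, hxt⟩
    have : cell u (t + ((x - cell u t : ℤ) : ℝ) * u) = x := by
      rw [cell_add_mul H.pos]; ring
    refine ⟨t + ((x - cell u t : ℤ) : ℝ) * u, by rwa [Set.mem_preimage, this], ?_⟩
    rw [H.R_iterate_eq, this, hxt]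
    push_cast
    ring

theorem infMatrix_eq (t : ℝ) (m l : ℤ) [Decidable (0 ≤ cell u t - m * p + l * q ∧
    cell u t - m * p + l * q < M * q + r)] : infMatrix a b c t m l =
    if 0 ≤ cell u t - m * p + l * q ∧ cell u t - m * p + l * q < M * q + r then 1 else 0 := by
  have e1 : t - (m : ℝ) * a + l * b = t + ((-m * p + l * q : ℤ) : ℝ) * u := by
    rw [H.a_eq, H.b_eq]; push_cast; ring
  have e2 : cell u (t - (m : ℝ) * a + l * b) = cell u t - m * p + l * q := by
    rw [e1, cell_add_mul H.pos]; ring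
  have e3 : t - (m : ℝ) * a + l * b ∈ Set.Ico 0 c ↔
      0 ≤ cell u t - m * p + l * q ∧ cell u t - m * p + l * q < M * q + r := by
    rw [← e2, cell_lt H.pos, ← H.c_eq, le_cell H.pos, Int.cast_zero, zero_mul, Set.mem_Ico]
  rw [infMatrix, Set.indicator_apply]
  exact if_congr e3 rfl rfl

theorem mem_invSet_iff : t ∈ invSet a b c ↔ cell u t ∈ core p q r M := by
  classical
  rw [mem_core_iff_exists_tiling H.adm H.le]
  have key : ∀ x : ℤ → ℝ, (∀ l, x l = 0 ∨ x l = 1) → ∀ m,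
      (HasSum (fun l : ℤ => infMatrix a b c t m l * x l) 1 ↔ ∃! l, x l = 1 ∧
        0 ≤ cell u t - m * p + l * q ∧ cell u t - m * p + l * q < M * q + r) := by
    intro x hx m
    have h1 : ∀ l, (infMatrix a b c t m l * x l = 1 ↔ x l = 1 ∧
        0 ≤ cell u t - m * p + l * q ∧ cell u t - m * p + l * q < M * q + r) := by
      intro l
      rw [H.infMatrix_eq]
      split_ifs with hc
      · simp [hc]
      · simp [hc]
    rw [hasSum_one_iff]
    · exact existsUnique_congr h1
    · intro l
      rw [H.infMatrix_eq]
      split_ifs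
      · simpa using hx l
      · simp
  constructor
  · rintro ⟨x, ⟨hx, hx0⟩, hs⟩
    exact ⟨{l | x l = 1}, hx0, fun m => (key x hx m).mp (hs m)⟩
  · rintro ⟨Λ, h0, hΛ⟩
    have hx : ∀ l, Λ.indicator (fun _ => (1 : ℝ)) l = 0 ∨ Λ.indicator (fun _ => (1 : ℝ)) l = 1 :=
      fun l => by by_cases hl : l ∈ Λ <;> simp [hl]
    refine ⟨Λ.indicator fun _ => 1, ⟨hx, by simp [h0]⟩, fun m => (key _ hx m).mpr ?_⟩
    have : ∀ l, Λ.indicator (fun _ => (1 : ℝ)) l = 1 ↔ l ∈ Λ := fun l => by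
      by_cases hl : l ∈ Λ <;> simp [hl]
    simpa only [this] using hΛ m

theorem invSet_eq : invSet a b c = cell u ⁻¹' core p q r M := by
  ext t
  exact H.mem_invSet_iff

theorem R_image_Ico (n : ℕ) (x y : ℤ) : (R a b c)^[n] '' Set.Ico ((x : ℝ) * u) (y * u) =
    cell u ⁻¹' ((stepZ p q r M)^[n] '' Set.Ico x y) := by
  rw [Ico_eq_preimage H.pos, H.R_iterate_image]

theorem add_lattice (E : Set ℤ) : cell u ⁻¹' E + lattice a = cell u ⁻¹' periodize p E := by
  rw [H.a_eq, preimage_add_lattice H.pos]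

theorem c_sub : c - c₀ b c = (M * q : ℤ) * u := by
  rw [H.c_eq, ← H.c_eq, H.c₀_eq, H.c_eq]; push_cast; ring

theorem bigGap_eq (δ δ' : ℤ) (n : ℕ) :
    bigGap a b c (δ * u) (δ' * u) n = cell u ⁻¹' bigGapZ p q r M δ δ' n := by
  have e1 : c - c₀ b c + δ' * u = ((M * q + δ' : ℤ) : ℝ) * u := by
    rw [H.c_sub]; push_cast; ring
  have e2 : c - c₀ b c + (b - a + δ * u) = ((M * q + (q - p + δ) : ℤ) : ℝ) * u := by
    rw [H.c_sub, H.a_eq, H.b_eq]; push_cast; ring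
  rw [bigGap, e1, e2, H.R_image_Ico, H.add_lattice, bigGapZ]

theorem c₀_add_sub : c₀ b c + a - b = ((r + p - q : ℤ) : ℝ) * u := by
  rw [H.c₀_eq, H.a_eq, H.b_eq]; push_cast; ring

theorem c₀_add_sub_sub (δ : ℤ) : c₀ b c + a - b - δ * u = ((r + p - q - δ : ℤ) : ℝ) * u := by
  rw [H.c₀_add_sub]; push_cast; ring

theorem c₀_sub (δ' : ℤ) : c₀ b c - δ' * u = ((r - δ' : ℤ) : ℝ) * u := by
  rw [H.c₀_eq]; push_cast; ring

theorem smallGap_eq (δ δ' : ℤ) (m : ℕ) :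
    smallGap a b c (δ * u) (δ' * u) m = cell u ⁻¹' smallGapZ p q r M δ δ' m := by
  rw [smallGap, H.c₀_add_sub_sub, H.c₀_sub, H.c₀_add_sub, H.c₀_eq, Ico_eq_preimage H.pos,
    Ico_eq_preimage H.pos, ← Set.preimage_sdiff, H.R_iterate_image, H.add_lattice, smallGapZ]

theorem R_endpoint (δ : ℤ) (n : ℕ) :
    (R a b c)^[n] (c - c₀ b c + b - a + δ * u) = endpoint p q r M δ n * u := by
  have : c - c₀ b c + b - a + δ * u = ((M * q + q - p + δ : ℤ) : ℝ) * u := by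
    rw [H.c_sub, H.a_eq, H.b_eq]; push_cast; ring
  rw [this, H.R_iterate_mul, endpoint]

theorem singleton_add_Ico_add_lattice (m x y : ℤ) :
    {(m : ℝ) * u} + Set.Ico ((x : ℝ) * u) (y * u) + lattice a =
      cell u ⁻¹' periodize p (Set.Ico (m + x) (m + y)) := by
  rw [singleton_add_Ico H.pos, H.add_lattice]

end Scaled

/-- Cells whose indices differ by at least 2 are at least u apart, and the half-open enlargements by
u/2 can only touch. -/
theorem disjoint_fatten (hu : 0 < u) {E F : Set ℤ} (hEF : ∀ x ∈ E, ∀ y ∈ F, 2 ≤ |x - y|) :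
    Disjoint (fatten (u / 2) (cell u ⁻¹' E)) (fatten (u / 2) (cell u ⁻¹' F)) := by
  rw [Set.disjoint_left]
  rintro _ ⟨x, hx, e, he, rfl⟩ ⟨y, hy, f, hf, hxy⟩
  have hxy : y + f = x + e := hxy
  have h2 := hEF _ hx _ hy
  have hx1 := cell_mul_le hu x
  have hx2 := lt_cell_mul hu x
  have hy1 := cell_mul_le hu y
  have hy2 := lt_cell_mul hu y
  rw [Set.mem_Ico] at he hf
  have h3 : cell u x < cell u y + 2 := by
    have : (cell u x : ℝ) * u < (cell u y + 2) * u := by linarith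
    exact_mod_cast lt_of_mul_lt_mul_right this hu.le
  have h4 : cell u y < cell u x + 2 := by
    have : (cell u y : ℝ) * u < (cell u x + 2) * u := by linarith
    exact_mod_cast lt_of_mul_lt_mul_right this hu.le
  rw [le_abs] at h2
  omega

theorem disjoint_fatten_point (hu : 0 < u) {E : Set ℤ} {m : ℤ}
    (hE : ∀ x ∈ E, ∀ j, x ≠ m + p * j ∧ x ≠ m - 1 + p * j) :
    Disjoint (fatten (u / 2) (cell u ⁻¹' E))
      ({(m : ℝ) * u} + Set.Ico (-(u / 2)) (u / 2) + lattice (p * u)) := by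
  rw [Set.disjoint_left]
  rintro _ ⟨x, hx, e, he, rfl⟩ hm
  obtain ⟨k, y, rfl, f, hf, hxy⟩ := mem_add_lattice.mp hm
  have hxy : (m : ℝ) * u + f = x + e + k * (p * u) := hxy
  rw [Set.mem_Ico] at he hf
  have h1 : m + p * -k - 1 ≤ cell u x := by
    rw [le_cell hu]; push_cast; linarith
  have h2 : cell u x < m + p * -k + 1 := by
    rw [cell_lt hu]; push_cast; linarith
  have := hE _ hx (-k)
  omega

theorem disjoint_point_point (hu : 0 < u) {m m' : ℤ} (hm : ∀ j, m ≠ m' + p * j) :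
    Disjoint ({(m : ℝ) * u} + Set.Ico (-(u / 2)) (u / 2) + lattice (p * u))
      ({(m' : ℝ) * u} + Set.Ico (-(u / 2)) (u / 2) + lattice (p * u)) := by
  rw [Set.disjoint_left]
  rintro t h h'
  obtain ⟨k, y, rfl, f, hf, hxy⟩ := mem_add_lattice.mp h
  obtain ⟨k', y', rfl, f', hf', hxy'⟩ := mem_add_lattice.mp h'
  have hxy : (m : ℝ) * u + f = t + k * (p * u) := hxy
  have hxy' : (m' : ℝ) * u + f' = t + k' * (p * u) := hxy'
  rw [Set.mem_Ico] at hf hf'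
  have h1 : m < m' + p * (k - k') + 1 := by
    have : (m : ℝ) * u < (m' + p * (k - k') + 1) * u := by linarith
    exact_mod_cast lt_of_mul_lt_mul_right this hu.le
  have h2 : m' + p * (k - k') < m + 1 := by
    have : ((m' : ℝ) + p * (k - k')) * u < (m + 1) * u := by linarith
    exact_mod_cast lt_of_mul_lt_mul_right this hu.le
  exact hm (k - k') (by omega)

theorem exists_scaled (ha : 0 < a) (hab : a < b) (hc₀ : b - a < c₀ b c) (hc₀' : c₀ b c < a)
    (hfloor : 1 ≤ ⌊c / b⌋) {p q : ℕ} (hratio : a / b = (p : ℝ) / (q : ℝ))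
    (hc : ∃ k : ℤ, c / b = (k : ℝ) / (q : ℝ)) :
    ∃ r M : ℤ, Scaled a b c (b / q) p q r M := by
  have hb : 0 < b := ha.trans hab
  have hq : (q : ℝ) ≠ 0 := by
    intro h0
    rw [h0, div_zero] at hratio
    exact (div_pos ha hb).ne' hratio
  have hq0 : (0 : ℝ) < q := lt_of_le_of_ne (Nat.cast_nonneg q) hq.symm
  have hu : 0 < b / q := div_pos hb hq0
  obtain ⟨k, hk⟩ := hc
  have hbe : b = q * (b / q) := by field_simp
  have hae : a = p * (b / q) := by
    field_simp at hratio ⊢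
    linarith
  have hce : c = k * (b / q) := by
    field_simp at hk ⊢
    linarith
  have h0 : c₀ b c = ((k - ⌊c / b⌋ * q : ℤ) : ℝ) * (b / q) := by
    rw [c₀]
    push_cast
    rw [sub_mul, ← hce, mul_assoc, ← hbe]
  refine ⟨k - ⌊c / b⌋ * q, ⌊c / b⌋, hu, ⟨?_, ?_, ?_⟩, hfloor, by exact_mod_cast hae,
    by exact_mod_cast hbe, ?_, h0, rfl⟩
  · have : (p : ℝ) * (b / q) < q * (b / q) := by rw [← hae, ← hbe]; exact hab
    exact_mod_cast lt_of_mul_lt_mul_right this hu.le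
  · have : ((q : ℝ) - p) * (b / q) < ((k - ⌊c / b⌋ * q : ℤ) : ℝ) * (b / q) := by
      rw [← h0, sub_mul, ← hae, ← hbe]; exact hc₀
    exact_mod_cast lt_of_mul_lt_mul_right this hu.le
  · have : ((k - ⌊c / b⌋ * q : ℤ) : ℝ) * (b / q) < p * (b / q) := by
      rw [← h0, ← hae]; exact hc₀'
    exact_mod_cast lt_of_mul_lt_mul_right this hu.le
  · rw [add_sub_cancel]; exact hce

end

end GaborABC

/-! ### Assembly of the theorem -/

theorem mainTheorem9 (a b c : ℝ) (ha : 0 < a) (hab : a < b) (hbc : b < c)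
    (hc₀ : b - a < GaborABC.c₀ b c) (hc₀' : GaborABC.c₀ b c < a) (hfloor : 2 ≤ ⌊c / b⌋)
    (p q : ℕ) (hpq : Nat.Coprime p q) (hratio : a / b = (p : ℝ) / (q : ℝ))
    (hc : ∃ k : ℤ, c / b = (k : ℝ) / (q : ℝ))
    (hS : (GaborABC.invSet a b c).Nonempty) :
    ∃ δ ∈ Set.Icc 0 (GaborABC.c₀ b c + a - b) ∩ GaborABC.lattice (b / q),
    ∃ δ' ∈ Set.Icc (GaborABC.c₀ b c - a) 0 ∩ GaborABC.lattice (b / q),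
    ∃ N₁ N₂ : ℕ,
      -- (i)
      δ * δ' = 0 ∧
      -- (ii)
      (∀ n ≤ N₁, GaborABC.bigGap a b c δ δ' n =
        {(GaborABC.R a b c)^[n] (c - GaborABC.c₀ b c + b - a + δ)} +
          Set.Ico (a - b + δ' - δ) 0 + GaborABC.lattice a) ∧
      GaborABC.bigGap a b c δ δ' N₁ =
        Set.Ico (GaborABC.c₀ b c + a - b - δ) (GaborABC.c₀ b c - δ') + GaborABC.lattice a ∧
      {(GaborABC.R a b c)^[N₁] (c - GaborABC.c₀ b c + b - a + δ)} + GaborABC.lattice a =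
        {GaborABC.c₀ b c - δ'} + GaborABC.lattice a ∧
      -- (iii)
      (∀ m, 1 ≤ m → m ≤ N₂ → GaborABC.smallGap a b c δ δ' m =
        {(GaborABC.R a b c)^[m] (GaborABC.c₀ b c - δ')} +
          Set.Ico (δ' - δ) 0 + GaborABC.lattice a) ∧
      GaborABC.smallGap a b c δ δ' N₂ = Set.Ico δ' δ + GaborABC.lattice a ∧
      -- (iii)'
      (δ = 0 → δ' = 0 → (GaborABC.R a b c)^[N₂] (GaborABC.c₀ b c) ∈ GaborABC.lattice a) ∧
      -- (iv)
      (δ - δ' ≠ 0 →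
        (∀ n ≤ N₁, ∀ n' ≤ N₁, n ≠ n' →
          Disjoint (GaborABC.fatten (b / (2 * q)) (GaborABC.bigGap a b c δ δ' n))
            (GaborABC.fatten (b / (2 * q)) (GaborABC.bigGap a b c δ δ' n'))) ∧
        (∀ m ∈ Set.Icc 1 N₂, ∀ m' ∈ Set.Icc 1 N₂, m ≠ m' →
          Disjoint (GaborABC.fatten (b / (2 * q)) (GaborABC.smallGap a b c δ δ' m))
            (GaborABC.fatten (b / (2 * q)) (GaborABC.smallGap a b c δ δ' m'))) ∧
        (∀ n ≤ N₁, ∀ m ∈ Set.Icc 1 N₂,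
          Disjoint (GaborABC.fatten (b / (2 * q)) (GaborABC.bigGap a b c δ δ' n))
            (GaborABC.fatten (b / (2 * q)) (GaborABC.smallGap a b c δ δ' m)))) ∧
      -- (iv)'
      (δ = 0 → δ' = 0 →
        (∀ n ≤ N₁, ∀ n' ≤ N₁, n ≠ n' →
          Disjoint (GaborABC.fatten (b / (2 * q)) (GaborABC.bigGap a b c 0 0 n))
            (GaborABC.fatten (b / (2 * q)) (GaborABC.bigGap a b c 0 0 n'))) ∧
        (∀ m ∈ Set.Icc 1 N₂, ∀ m' ∈ Set.Icc 1 N₂, m ≠ m' →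
          Disjoint
            ({(GaborABC.R a b c)^[m] (GaborABC.c₀ b c)} +
              Set.Ico (-(b / (2 * q))) (b / (2 * q)) + GaborABC.lattice a)
            ({(GaborABC.R a b c)^[m'] (GaborABC.c₀ b c)} +
              Set.Ico (-(b / (2 * q))) (b / (2 * q)) + GaborABC.lattice a)) ∧
        (∀ n ≤ N₁, ∀ m ∈ Set.Icc 1 N₂,
          Disjoint (GaborABC.fatten (b / (2 * q)) (GaborABC.bigGap a b c 0 0 n))
            ({(GaborABC.R a b c)^[m] (GaborABC.c₀ b c)} +
              Set.Ico (-(b / (2 * q))) (b / (2 * q)) + GaborABC.lattice a))) ∧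
      -- (v)
      (GaborABC.invSet a b c)ᶜ =
        (⋃ n ∈ Set.Icc 0 N₁, GaborABC.bigGap a b c δ δ' n) ∪
        (⋃ m ∈ Set.Icc 1 N₂, ((GaborABC.R a b c)^[m] ''
          Set.Ico (GaborABC.c₀ b c + a - b - δ) (GaborABC.c₀ b c - δ') + GaborABC.lattice a)) ∧
      (GaborABC.invSet a b c)ᶜ =
        (⋃ n ∈ Set.Icc 0 (N₁ + N₂), (GaborABC.R a b c)^[n] ''
          (Set.Ico (c - GaborABC.c₀ b c + δ') (c - GaborABC.c₀ b c + (b - a + δ)) +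
            GaborABC.lattice a)) ∧
      -- (vi)
      ∃ h : ℝ, 0 < h ∧
        GaborABC.invSet a b c =
          (⋃ n ∈ Set.Icc 0 (N₁ + N₂),
            ({(GaborABC.R a b c)^[n] (c - GaborABC.c₀ b c + b - a + δ)} +
              Set.Ico 0 h + GaborABC.lattice a)) ∧
        (∀ n ≤ N₁ + N₂, ∀ n' ≤ N₁ + N₂, n ≠ n' →
          Disjoint
            ({(GaborABC.R a b c)^[n] (c - GaborABC.c₀ b c + b - a + δ)} +
              Set.Ico 0 h + GaborABC.lattice a)
            ({(GaborABC.R a b c)^[n'] (c - GaborABC.c₀ b c + b - a + δ)} +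
              Set.Ico 0 h + GaborABC.lattice a)) ∧
        ((N₁ : ℝ) + N₂ + 1) * (h + δ - δ') + ((N₁ : ℝ) + 1) * (b - a) = a := by
  obtain ⟨r, M, H⟩ := GaborABC.exists_scaled ha hab hc₀ hc₀' (by omega) hratio hc
  have hb : 0 < b := ha.trans hab
  have hne : (GaborABC.core p q r M).Nonempty := by
    obtain ⟨t, ht⟩ := hS
    exact ⟨_, H.mem_invSet_iff.mp ht⟩
  obtain ⟨δ, δ', w, N₁, N₂, G⟩ := GaborABC.exists_gapStructure H.adm hne
  have hu := H.pos
  rw [show b / (2 * (q : ℝ)) = b / q / 2 by rw [div_div, mul_comm]]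
  generalize b / (q : ℝ) = u at *
  have hmem : ∀ x y z : ℤ, x ≤ y → y ≤ z → (y : ℝ) * u ∈ Set.Icc ((x : ℝ) * u) (z * u) := by
    intro x y z h₁ h₂
    exact ⟨mul_le_mul_of_nonneg_right (by exact_mod_cast h₁) hu.le,
      mul_le_mul_of_nonneg_right (by exact_mod_cast h₂) hu.le⟩
  have hzero : ∀ x : ℤ, (x : ℝ) * u = 0 → x = 0 := by
    intro x hx
    exact_mod_cast (mul_eq_zero.mp hx).resolve_right hu.ne'
  have hpoint : ∀ m, (GaborABC.R a b c)^[m] (GaborABC.c₀ b c - δ' * u) =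
      ((GaborABC.stepZ p q r M)^[m] (r - δ') : ℤ) * u := fun m => by
    rw [H.c₀_sub, H.R_iterate_mul]
  have hblock : ∀ n, {(GaborABC.R a b c)^[n] (c - GaborABC.c₀ b c + b - a + δ * u)} +
      Set.Ico 0 ((w : ℝ) * u) + GaborABC.lattice a = GaborABC.cell u ⁻¹'
        GaborABC.periodize p (Set.Ico (GaborABC.endpoint p q r M δ n)
          (GaborABC.endpoint p q r M δ n + w)) := by
    intro n
    have := H.singleton_add_Ico_add_lattice (GaborABC.endpoint p q r M δ n) 0 w
    rwa [Int.cast_zero, zero_mul, add_zero, ← H.R_endpoint] at this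
  refine ⟨δ * u, ⟨?_, δ, rfl⟩, δ' * u, ⟨?_, δ', rfl⟩, N₁, N₂, ?_, ?_, ?_, ?_, ?_, ?_, ?_, ?_, ?_,
    ?_, ?_, w * u, mul_pos (by exact_mod_cast G.w_pos) hu, ?_, ?_, ?_⟩
  · have := hmem 0 δ (r + p - q) G.δ_nonneg G.δ_le
    rwa [← H.c₀_add_sub, Int.cast_zero, zero_mul] at this
  · have := hmem (r - p) δ' 0 G.le_δ' G.δ'_nonpos
    rwa [Int.cast_zero, zero_mul, Int.cast_sub, sub_mul, Int.cast_natCast (R := ℝ) p, ← H.c₀_eq,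
      ← Int.cast_natCast (R := ℝ) p, ← H.a_eq] at this
  · have : (δ : ℝ) * δ' = 0 := by exact_mod_cast G.mul_eq_zero
    rw [mul_mul_mul_comm, this, zero_mul]
  · intro n hn
    have := H.singleton_add_Ico_add_lattice (GaborABC.endpoint p q r M δ n) (p - q + δ' - δ) 0
    rw [Int.cast_zero, zero_mul, add_zero, ← G.big_eq n hn, ← H.bigGap_eq, ← H.R_endpoint,
      show ((p - q + δ' - δ : ℤ) : ℝ) * u = a - b + δ' * u - δ * u by
        rw [H.a_eq, H.b_eq]; push_cast; ring] at this
    exact this.symm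
  · rw [H.bigGap_eq, G.big_last, H.c₀_add_sub_sub, H.c₀_sub, GaborABC.Ico_eq_preimage hu,
      H.add_lattice]
  · obtain ⟨j, hj⟩ := G.endpoint_last
    rw [H.R_endpoint, hj, H.c₀_sub, H.a_eq]
    ext t
    simp only [GaborABC.mem_add_lattice, Set.mem_singleton_iff]
    constructor
    · rintro ⟨k, hk⟩
      exact ⟨k - j, by push_cast at hk ⊢; linear_combination hk⟩
    · rintro ⟨k, hk⟩
      exact ⟨k + j, by push_cast at hk ⊢; linear_combination hk⟩
  · intro m hm hm'
    have := H.singleton_add_Ico_add_lattice ((GaborABC.stepZ p q r M)^[m] (r - δ')) (δ' - δ) 0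
    rw [Int.cast_zero, zero_mul, add_zero, ← G.small_eq m hm hm', ← H.smallGap_eq, ← hpoint,
      Int.cast_sub, sub_mul] at this
    exact this.symm
  · rw [H.smallGap_eq, G.small_last, GaborABC.Ico_eq_preimage hu, H.add_lattice]
  · intro h₁ h₂
    obtain ⟨j, hj⟩ := G.origin (hzero _ h₁) (hzero _ h₂)
    rw [H.c₀_eq, H.R_iterate_mul, hj]
    exact ⟨j, by rw [H.a_eq]; push_cast; ring⟩
  · intro _
    refine ⟨fun n hn n' hn' hne => ?_, fun m hm m' hm' hne => ?_, fun n hn m hm => ?_⟩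
    · rw [H.bigGap_eq, H.bigGap_eq]
      exact GaborABC.disjoint_fatten hu (G.sep_big n hn n' hn' hne)
    · rw [H.smallGap_eq, H.smallGap_eq]
      exact GaborABC.disjoint_fatten hu (G.sep_small m hm m' hm' hne)
    · rw [H.bigGap_eq, H.smallGap_eq]
      exact GaborABC.disjoint_fatten hu (G.sep_mixed n hn m hm)
  · intro h₁ h₂
    have hbig : ∀ n, GaborABC.bigGap a b c 0 0 n =
        GaborABC.cell u ⁻¹' GaborABC.bigGapZ p q r M δ δ' n := fun n => by
      rw [← H.bigGap_eq, h₁, h₂]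
    have hc₀m : ∀ m, (GaborABC.R a b c)^[m] (GaborABC.c₀ b c) =
        ((GaborABC.stepZ p q r M)^[m] (r - δ') : ℤ) * u := fun m => by
      rw [← hpoint, h₂, sub_zero]
    have hl : GaborABC.lattice a = GaborABC.lattice (((p : ℤ) : ℝ) * u) := congrArg _ H.a_eq
    simp only [hbig, hc₀m, hl]
    refine ⟨fun n hn n' hn' hne => ?_, fun m hm m' hm' hne => ?_, fun n hn m hm => ?_⟩
    · exact GaborABC.disjoint_fatten hu (G.sep_big n hn n' hn' hne)
    · exact GaborABC.disjoint_point_point hu (G.sep_point m hm m' hm' hne)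
    · exact GaborABC.disjoint_fatten_point hu (G.sep_big_point n hn m hm)
  · rw [H.invSet_eq, ← Set.preimage_compl, G.compl_eq, Set.preimage_union]
    simp only [Set.preimage_iUnion, H.bigGap_eq, H.c₀_add_sub_sub, H.c₀_sub, H.R_image_Ico,
      H.add_lattice]
  · rw [H.invSet_eq, ← Set.preimage_compl, G.compl_eq']
    simp only [Set.preimage_iUnion]
    refine Set.iUnion₂_congr fun n _ => ?_
    have e1 : c - GaborABC.c₀ b c + δ' * u = ((M * q + δ' : ℤ) : ℝ) * u := by
      rw [H.c_sub]; push_cast; ring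
    have e2 : c - GaborABC.c₀ b c + (b - a + δ * u) = ((M * q + (q - p + δ) : ℤ) : ℝ) * u := by
      rw [H.c_sub, H.a_eq, H.b_eq]; push_cast; ring
    rw [e1, e2, GaborABC.Ico_eq_preimage hu, H.add_lattice, H.R_iterate_image,
      GaborABC.image_stepZ_periodize, GaborABC.bigGapZ]
  · rw [H.invSet_eq, G.core_eq]
    simp only [Set.preimage_iUnion, hblock]
  · intro n hn n' hn' hne
    rw [hblock, hblock]
    exact (G.disjoint n hn n' hn' hne).preimage _
  · have h₁ : ((N₁ : ℝ) + N₂ + 1) * (w + δ - δ') + (N₁ + 1) * (q - p) = p := by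
      exact_mod_cast G.count
    rw [H.a_eq, H.b_eq]
    push_cast
    linear_combination u * h₁
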